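/- **Error bound of Algorithm TTF.** Let $G=(V,E)$ be a finite simple connected undirected graph with $n\ge 2$ nodes, $m$ edges and diameter $\Delta$. Write $d(v)$ for the degree of $v$ in $G$ and $\mathrm{vol}(S)=\sum_{v\in S}d(v)$ for $S\subseteq V$. Let $$\kappa=\kappa(G)=\sum_{j\in V}\frac{d(j)}{2m}\,H(i,j)$$ be the Kemeny constant of $G$, where $i\in V$ is any node ($\kappa$ does not depend on it) and $H(i,j)$ is the expected number of steps that the simple random walk started at $i$ needs to visit $j$ for the first time. Fix a root $r\in V$ and a breadth-first search tree $\tau_0$ of $G$ rooted at $r$, that is, a spanning tree in which every node has the same distance from $r$ as in $G$. For a spanning tree $\tau$ of $G$ rooted at $r$, let $\mathrm{Sub}(\tau,v)$ be the node set of the subtree rooted at $v$, and for $v\ne r$ let $p(v)$ be the parent of $v$ in $\tau$. Edges of rooted trees are directed from child to parent. Let $\tau_1,\dots,\tau_\omega$ be independent uniformly random spanning trees of $G$ (the samples drawn by the algorithm). The algorithm TTF starts with an array $\mathrm{volsum}[v]=0$ $(v\in V)$ and calls $\mathrm{DFS}(r,\tau_k,\tau_0)$ for $k=1,\dots,\omega$.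 The call $\mathrm{DFS}(v,\tau,\tau_0)$ does the following. 1. If $v\ne r$ and $(v,p(v))\in\tau_0$, add $2m-\mathrm{vol}(\mathrm{Sub}(\tau,v))$ to $\mathrm{volsum}[u]$ for all $u\in\mathrm{Sub}(\tau_0,v)$. If instead $v\ne r$ and $(p(v),v)\in\tau_0$, subtract $2m-\mathrm{vol}(\mathrm{Sub}(\tau,v))$ from $\mathrm{volsum}[u]$ for all $u\in\mathrm{Sub}(\tau_0,p(v))$. 2. Start the return value at $d(v)\cdot\mathrm{volsum}[v]$, and add to it the values of the recursive calls on the children of $v$ in $\tau$. 3. Undo the update of step 1 and return the value. The output is $$\tilde\kappa=\frac{1}{2m\omega}\sum_{k=1}^{\omega}\mathrm{DFS}(r,\tau_k,\tau_0).$$ Let $\varepsilon>0$ and $p_f>0$. If the sample size satisfies $$\omega\;\ge\;\frac{8m^2\Delta^2\log(2/p_f)}{n^2\varepsilon^2},$$ then $|\tilde\kappa-\kappa|\le\varepsilon\kappa$ with probability at least $1-p_f$. -/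

import Mathlib

open MeasureTheory ProbabilityTheory
open scoped ENNReal

noncomputable section

namespace TTF

/-! ### Random walk and Kemeny constant -/

section Kemeny

variable {V : Type*} [Fintype V] [DecidableEq V] (G : SimpleGraph V) [DecidableRel G.Adj]

/-- The transition matrix `P = D⁻¹ A` of the simple random walk on `G`. -/
def transition (i j : V) : ℝ := G.adjMatrix ℝ i j / (G.degree i : ℝ)

/-- The stationary distribution `π i = d i / (2 m)`. -/
def stationary (i : V) : ℝ := (G.degree i : ℝ) / (2 * (G.edgeFinset.card : ℝ))

/-- `ℙ_i (T_j > k)`, where `T_j` is the first time (time `0` included) at which the walk is at `j`: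
the total probability of the trajectories `x 0, …, x k` that start at `i` and avoid `j`. -/
def avoidProb (i j : V) (k : ℕ) : ℝ :=
  ∑ x : Fin (k + 1) → V with x 0 = i ∧ ∀ s, x s ≠ j,
    ∏ s : Fin k, transition G (x s.castSucc) (x s.succ)

/-- The hitting time `H(i, j) = 𝔼_i [T_j] = ∑_{k ≥ 0} ℙ_i (T_j > k)`, with values in `[0, ∞]`. -/
def hittingTime (i j : V) : ℝ≥0∞ := ∑' k : ℕ, ENNReal.ofReal (avoidProb G i j k)

/-- The Kemeny constant `κ(G) = ∑_j π_j H(i, j)`, computed from the start node `i`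
(its value does not depend on `i` when `G` is connected). -/
def kemeny (i : V) : ℝ := ∑ j, stationary G j * (hittingTime G i j).toReal

end Kemeny

/-! ### Spanning trees, rooted at `r` -/

section Trees

variable {V : Type*}

/-- The set `Γ` of spanning trees of `G`. -/
def SpanningTree (G : SimpleGraph V) : Type _ := {T : SimpleGraph V // T ≤ G ∧ T.IsTree}

instance (G : SimpleGraph V) : MeasurableSpace (SpanningTree G) := ⊤

/-- `T₀` is a breadth-first search tree of `G` with root `r`: a spanning tree in which the distance
of every node from the root is its distance from the root in `G`. -/
def IsBFSTree (G : SimpleGraph V) (r : V) (T₀ : SpanningTree G) : Prop :=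
  ∀ u, T₀.1.dist r u = G.dist r u

/-- In the tree `T` rooted at `r`, the node `p` is the parent of `v`; in other words the edge
`(v, p)`, directed towards the root, belongs to `T`. -/
def IsParent (T : SimpleGraph V) (r p v : V) : Prop :=
  T.Adj v p ∧ T.dist r v = T.dist r p + 1

open scoped Classical in
/-- The parent `p(v)` of `v` in the tree `T` rooted at `r`. The root, which has no parent, is
sent to itself; `(r, r)` is never an edge. -/
def parent (T : SimpleGraph V) (r v : V) : V :=
  if h : ∃ p, IsParent T r p v then h.choose else v

/-- The node set `Sub(T, v)` of the subtree rooted at `v` in the tree `T` rooted at `r`: the nodes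
whose path to `r` in `T` passes through `v`. -/
def subtree (T : SimpleGraph V) (r v : V) : Set V :=
  {u | ∃ p : T.Walk u r, p.IsPath ∧ v ∈ p.support}

end Trees

/-! ### The algorithm -/

section Algorithm

variable {V : Type*} [Fintype V] [DecidableEq V] (G : SimpleGraph V) [DecidableRel G.Adj]

open scoped Classical in
/-- The children of `v` in the tree `T` rooted at `r`, listed in some order. -/
def children (T : SimpleGraph V) (r v : V) : List V :=
  (Finset.univ.filter fun c => IsParent T r v c).toList

open scoped Classical in
/-- The volume `vol(S) = ∑_{u ∈ S} d(u)`, with degrees taken in `G`. -/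
def vol (S : Set V) : ℝ := ∑ u with u ∈ S, (G.degree u : ℝ)

open scoped Classical in
/-- The operation `Add` on the array `volSum`: add `c` to the entries of all nodes of
`Sub(T₀, x)`, which form an interval in the depth-first numbering of `T₀`. -/
def rangeAdd (T₀ : SimpleGraph V) (r x : V) (c : ℝ) (volSum : V → ℝ) : V → ℝ :=
  fun u => if u ∈ subtree T₀ r x then volSum u + c else volSum u

open scoped Classical in
/-- The update of `volSum` on entering `v`. -/
def enter (T T₀ : SimpleGraph V) (r v : V) (volSum : V → ℝ) : V → ℝ :=
  if IsParent T₀ r (parent T r v) v then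
    rangeAdd T₀ r v (2 * (G.edgeFinset.card : ℝ) - vol G (subtree T r v)) volSum
  else if IsParent T₀ r v (parent T r v) then
    rangeAdd T₀ r (parent T r v) (vol G (subtree T r v) - 2 * (G.edgeFinset.card : ℝ)) volSum
  else volSum

open scoped Classical in
/-- The update of `volSum` on leaving `v`, which reverts `enter`. -/
def leave (T T₀ : SimpleGraph V) (r v : V) (volSum : V → ℝ) : V → ℝ :=
  if IsParent T₀ r (parent T r v) v then
    rangeAdd T₀ r v (vol G (subtree T r v) - 2 * (G.edgeFinset.card : ℝ)) volSum
  else if IsParent T₀ r v (parent T r v) then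
    rangeAdd T₀ r (parent T r v) (2 * (G.edgeFinset.card : ℝ) - vol G (subtree T r v)) volSum
  else volSum

/-- The procedure `DFS(v, T, T₀)`. It takes the current array `volSum` and returns the accumulated
value together with the array after the call. The first argument only bounds the depth of the
recursion; started with `n` at the root of a tree on `n` nodes it never runs out. -/
def dfs (T T₀ : SimpleGraph V) (r : V) : ℕ → V → (V → ℝ) → ℝ × (V → ℝ)
  | 0, _, volSum => (0, volSum)
  | fuel + 1, v, volSum =>
    let volSum₁ := enter G T T₀ r v volSum
    let out := (children T r v).foldl
      (fun st c =>
        let res := dfs T T₀ r fuel c st.2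
        (st.1 + res.1, res.2))
      ((G.degree v : ℝ) * volSum₁ v, volSum₁)
    (out.1, leave G T T₀ r v out.2)

/-- The output of the algorithm TTF with root `r` and fixed tree `T₀` on the sampled spanning trees
`τ 0, …, τ (ω - 1)`: `volSum` starts at zero, the values of the calls `DFS(r, τ i, T₀)` are
summed, and the sum is divided by `2 m ω`. -/
def ttf (r : V) (T₀ : SpanningTree G) {ω : ℕ} (τ : Fin ω → SpanningTree G) : ℝ :=
  ((List.ofFn τ).foldl
    (fun st T =>
      let res := dfs G T.1 T₀.1 r (Fintype.card V) r st.2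
      (st.1 + res.1, res.2))
    ((0 : ℝ), fun _ : V => (0 : ℝ))).1 / (2 * (G.edgeFinset.card : ℝ) * (ω : ℝ))

end Algorithm

end TTF

end

set_option linter.unusedSectionVars false

namespace TTF

/-! ### Trees rooted at `r`: parents, subtrees, cutting one edge. -/

section RootedTrees

variable {V : Type*} {T : SimpleGraph V} {r : V}

/-! Write M = 2m and n = |V|. The output is the mean of ω i.i.d. values `sampleValue`, divided by M.
The proof shows that a sample has expectation Mκ and absolute value at most B = M²Δ(n-1)²/n², and
then applies Hoeffding's inequality.

Expectation. For each pair (v, y), weighted by d(v)d(y), a sample counts the edges of the `T₀`-path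
from v to r that lie, with sign, on the way from v to r in the random tree but not on the way from y
to r. Deleting an edge turns the trees that use it in this manner into spanning 2-forests, so the
net count over all trees is the difference of a potential, `forestCount`, between the ends of the
edge (`sum_usesEdge`). The sum telescopes along the `T₀`-path to the number of forests that separate
v from y and r. Weighted by d(y) and divided by the number of trees, this is `potential G v r`.
Kirchhoff's current law in each single tree (`sum_usesEdge_of_tree`) shows that `potential`
satisfies the one-step equations of the hitting time, and hence equals it. Any spanning tree `T₀`
gives the same expectation.

Range. Each edge of `T₀` contributes at most x(M - x) in absolute value, where x is a volume bounded
by that of the `T₀`-subtree below the edge. Those subtree volumes add up to Σ d(v) dist(r, v); this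
is where the breadth-first property brings in Δ. Tangent lines to the parabola x(M - x) give B
(`abs_sampleValue_le`).

Relative error. Cauchy-Schwarz for the Dirichlet form yields κ ≥ (n-1)²/n (`le_kemeny`). The factor
(n-1)² cancels against the one in B, leaving B/(Mκ) ≤ MΔ/n; with M = 2m this is exactly the constant
in the sample size. -/

lemma IsParent.adj {p v : V} (h : IsParent T r p v) : T.Adj v p := h.1

lemma IsParent.ne_root {p v : V} (h : IsParent T r p v) : v ≠ r := by
  rintro rfl
  simpa using h.2

lemma not_isParent_root (p : V) : ¬ IsParent T r p r := fun h => h.ne_root rfl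

lemma IsParent.asymm {p v : V} (h : IsParent T r p v) : ¬ IsParent T r v p := by
  intro h'
  have := h.2
  have := h'.2
  omega

lemma IsParent.exists_isPath (hT : T.IsTree) {p v : V} (h : IsParent T r p v) :
    ∃ q : T.Walk p r, q.IsPath ∧ (SimpleGraph.Walk.cons h.adj q).IsPath := by
  obtain ⟨q, hq, hl⟩ := hT.connected.exists_path_of_dist p r
  refine ⟨q, hq, SimpleGraph.Walk.isPath_of_length_eq_dist _ ?_⟩
  rw [SimpleGraph.Walk.length_cons, hl, T.dist_comm, T.dist_comm (u := v), h.2]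

lemma IsParent.unique (hT : T.IsTree) {p q v : V} (hp : IsParent T r p v)
    (hq : IsParent T r q v) : p = q := by
  obtain ⟨a, -, ha⟩ := hp.exists_isPath hT
  obtain ⟨b, -, hb⟩ := hq.exists_isPath hT
  have := (hT.existsUnique_path v r).unique ha hb
  simpa using congrArg (fun w : T.Walk v r => w.snd) this

lemma exists_isParent (hT : T.IsTree) {v : V} (hv : v ≠ r) : ∃ p, IsParent T r p v := by
  obtain ⟨q, hq, hl⟩ := hT.connected.exists_path_of_dist v r
  cases q with
  | nil => exact absurd rfl hv
  | @cons _ p _ h q =>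
    refine ⟨p, h, ?_⟩
    have h1 := SimpleGraph.dist_le q
    rw [SimpleGraph.Walk.length_cons, T.dist_comm] at hl
    rw [T.dist_comm] at h1
    have h2 := hT.dist_eq_dist_add_one_of_adj r h
    omega

lemma isParent_or_isParent (hT : T.IsTree) {a b : V} (h : T.Adj a b) :
    IsParent T r b a ∨ IsParent T r a b :=
  (hT.dist_eq_dist_add_one_of_adj r h).imp (fun h' => ⟨h, h'⟩) fun h' => ⟨h.symm, h'⟩

lemma parent_eq (hT : T.IsTree) {p v : V} (h : IsParent T r p v) : parent T r v = p := by
  have h' : ∃ p, IsParent T r p v := ⟨p, h⟩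
  rw [parent, dif_pos h']
  exact h'.choose_spec.unique hT h

lemma parent_root : parent T r r = r := by
  rw [parent, dif_neg]
  rintro ⟨p, hp⟩
  exact hp.ne_root rfl

lemma isParent_parent (hT : T.IsTree) {v : V} (hv : v ≠ r) : IsParent T r (parent T r v) v := by
  obtain ⟨p, hp⟩ := exists_isParent hT hv
  rwa [parent_eq hT hp]

/-- Induction along a rooted tree, from the root towards the leaves. -/
lemma parent_induction (hT : T.IsTree) {P : V → Prop} (root : P r)
    (step : ∀ p v, IsParent T r p v → P p → P v) (v : V) : P v := by
  induction h : T.dist r v generalizing v with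
  | zero =>
    rw [hT.connected.dist_eq_zero_iff] at h
    exact h ▸ root
  | succ n ih =>
    have hv : v ≠ r := by
      rintro rfl
      simp at h
    obtain ⟨p, hp⟩ := exists_isParent hT hv
    refine step p v hp (ih p ?_)
    have := hp.2
    omega

lemma mem_subtree_self (hT : T.IsTree) (v : V) : v ∈ subtree T r v := by
  obtain ⟨q, hq, -⟩ := hT.existsUnique_path v r
  exact ⟨q, hq, q.start_mem_support⟩

lemma mem_subtree_root (hT : T.IsTree) (v : V) : v ∈ subtree T r r := by
  obtain ⟨q, hq, -⟩ := hT.existsUnique_path v r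
  exact ⟨q, hq, q.end_mem_support⟩

lemma root_mem_subtree_iff {v : V} : r ∈ subtree T r v ↔ v = r := by
  constructor
  · rintro ⟨q, hq, hv⟩
    have h := SimpleGraph.Walk.isPath_iff_nil.1 hq
    rw [SimpleGraph.Walk.nil_iff_support_eq.1 h] at hv
    simpa using hv
  · rintro rfl
    exact ⟨.nil, by simp, by simp⟩

lemma IsParent.mem_subtree_iff (hT : T.IsTree) {p u : V} (h : IsParent T r p u) (v : V) :
    u ∈ subtree T r v ↔ u = v ∨ p ∈ subtree T r v := by
  obtain ⟨q, hq, hc⟩ := h.exists_isPath hT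
  constructor
  · rintro ⟨w, hw, hv⟩
    rw [(hT.existsUnique_path u r).unique hw hc, SimpleGraph.Walk.support_cons,
      List.mem_cons] at hv
    rcases hv with hv | hv
    · exact Or.inl hv.symm
    · exact Or.inr ⟨q, hq, hv⟩
  · rintro (rfl | ⟨w, hw, hv⟩)
    · exact mem_subtree_self hT _
    · refine ⟨_, hc, ?_⟩
      rw [(hT.existsUnique_path p r).unique hq hw]
      simp [hv]

lemma dist_le_of_mem_subtree (hT : T.IsTree) {u v : V} (h : u ∈ subtree T r v) :
    T.dist r v ≤ T.dist r u := by
  induction u using parent_induction hT (r := r) with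
  | root => rw [root_mem_subtree_iff.1 h]
  | step p u hp ih =>
    rcases (hp.mem_subtree_iff hT v).1 h with rfl | h
    · rfl
    · have := ih h
      have := hp.2
      omega

lemma IsParent.not_mem_subtree (hT : T.IsTree) {p v : V} (h : IsParent T r p v) :
    p ∉ subtree T r v := by
  intro hp
  have := dist_le_of_mem_subtree hT hp
  have := h.2
  omega

lemma subtree_trans (hT : T.IsTree) {u v w : V} (h : u ∈ subtree T r v)
    (h' : v ∈ subtree T r w) : u ∈ subtree T r w := by
  induction u using parent_induction hT (r := r) with
  | root =>
    obtain rfl := root_mem_subtree_iff.1 h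
    exact h'
  | step p u hp ih =>
    rcases (hp.mem_subtree_iff hT v).1 h with rfl | h
    · exact h'
    · exact (hp.mem_subtree_iff hT w).2 (Or.inr (ih h))

lemma subtree_antisymm (hT : T.IsTree) {u v : V} (h : u ∈ subtree T r v)
    (h' : v ∈ subtree T r u) : u = v := by
  by_cases hu : u = r
  · subst hu
    exact (root_mem_subtree_iff.1 h).symm
  · have hp := isParent_parent hT hu
    rcases (hp.mem_subtree_iff hT v).1 h with h | h
    · exact h
    · exact absurd (subtree_trans hT h h') (hp.not_mem_subtree hT)

lemma subtree_comparable (hT : T.IsTree) {u v w : V} (hv : u ∈ subtree T r v)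
    (hw : u ∈ subtree T r w) : v ∈ subtree T r w ∨ w ∈ subtree T r v := by
  induction u using parent_induction hT (r := r) with
  | root =>
    obtain rfl := root_mem_subtree_iff.1 hv
    exact Or.inl hw
  | step p u hp ih =>
    rcases (hp.mem_subtree_iff hT v).1 hv with rfl | h
    · exact Or.inl hw
    · rcases (hp.mem_subtree_iff hT w).1 hw with rfl | h'
      · exact Or.inr hv
      · exact ih h h'

/-- A node of the subtree rooted at `v` is `v` itself or lies in the subtree of one child. -/
lemma mem_subtree_iff_exists_child (hT : T.IsTree) {u v : V} :
    u ∈ subtree T r v ↔ u = v ∨ ∃ c, IsParent T r v c ∧ u ∈ subtree T r c := by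
  constructor
  · intro h
    induction u using parent_induction hT (r := r) with
    | root => exact Or.inl (root_mem_subtree_iff.1 h).symm
    | step p u hp ih =>
      rcases (hp.mem_subtree_iff hT v).1 h with rfl | h
      · exact Or.inl rfl
      · rcases ih h with rfl | ⟨c, hc, hpc⟩
        · exact Or.inr ⟨u, hp, mem_subtree_self hT u⟩
        · exact Or.inr ⟨c, hc, (hp.mem_subtree_iff hT c).2 (Or.inr hpc)⟩
  · rintro (rfl | ⟨c, hc, hu⟩)
    · exact mem_subtree_self hT _
    · exact subtree_trans hT hu ((hc.mem_subtree_iff hT v).2 (Or.inr (mem_subtree_self hT v)))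

lemma child_unique (hT : T.IsTree) {u v c d : V} (hc : IsParent T r v c) (hd : IsParent T r v d)
    (huc : u ∈ subtree T r c) (hud : u ∈ subtree T r d) : c = d := by
  rcases subtree_comparable hT huc hud with h | h
  · rcases (hc.mem_subtree_iff hT d).1 h with h | h
    · exact h
    · exact absurd h (hd.not_mem_subtree hT)
  · rcases (hd.mem_subtree_iff hT c).1 h with h | h
    · exact h.symm
    · exact absurd h (hc.not_mem_subtree hT)

/-- Climbing from u to a uses only edges strictly inside the subtree, so the deleted edge is never
met. Together with the next lemmas, this identifies the two components left by the deletion as the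
subtree of a and its complement. -/
lemma IsParent.reachable_deleteEdges_of_mem (hT : T.IsTree) {a b u : V} (h : IsParent T r b a)
    (hu : u ∈ subtree T r a) : (T.deleteEdges {s(a, b)}).Reachable u a := by
  induction u using parent_induction hT (r := r) with
  | root => exact absurd (root_mem_subtree_iff.1 hu) h.ne_root
  | step p u hp ih =>
    rcases (hp.mem_subtree_iff hT a).1 hu with rfl | hpa
    · rfl
    · refine SimpleGraph.Reachable.trans (SimpleGraph.Adj.reachable ?_) (ih hpa)
      rw [SimpleGraph.deleteEdges_adj, Set.mem_singleton_iff]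
      refine ⟨hp.adj, fun he => ?_⟩
      rcases Sym2.eq_iff.1 he with ⟨rfl, rfl⟩ | ⟨rfl, rfl⟩
      · exact h.not_mem_subtree hT hpa
      · exact hp.asymm h

lemma IsParent.reachable_deleteEdges_of_not_mem (hT : T.IsTree) {a b u : V}
    (h : IsParent T r b a) (hu : u ∉ subtree T r a) :
    (T.deleteEdges {s(a, b)}).Reachable u b := by
  have key : ∀ u, u ∉ subtree T r a → (T.deleteEdges {s(a, b)}).Reachable u r := by
    intro u hu
    induction u using parent_induction hT (r := r) with
    | root => rfl
    | step p u hp ih =>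
      rw [hp.mem_subtree_iff hT a, not_or] at hu
      refine SimpleGraph.Reachable.trans (SimpleGraph.Adj.reachable ?_) (ih hu.2)
      rw [SimpleGraph.deleteEdges_adj, Set.mem_singleton_iff]
      refine ⟨hp.adj, fun he => ?_⟩
      rcases Sym2.eq_iff.1 he with ⟨rfl, rfl⟩ | ⟨rfl, rfl⟩
      · exact hu.1 rfl
      · exact hp.asymm h
  exact (key u hu).trans (key b (h.not_mem_subtree hT)).symm

lemma not_reachable_deleteEdges (hT : T.IsTree) {a b : V} (h : T.Adj a b) :
    ¬ (T.deleteEdges {s(a, b)}).Reachable a b :=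
  SimpleGraph.isBridge_iff.1 (SimpleGraph.isAcyclic_iff_forall_adj_isBridge.1 hT.isAcyclic h)

lemma IsParent.reachable_deleteEdges_left (hT : T.IsTree) {a b u : V} (h : IsParent T r b a) :
    (T.deleteEdges {s(a, b)}).Reachable u a ↔ u ∈ subtree T r a := by
  refine ⟨fun hu => ?_, h.reachable_deleteEdges_of_mem hT⟩
  by_contra hn
  exact not_reachable_deleteEdges hT h.adj
    (hu.symm.trans (h.reachable_deleteEdges_of_not_mem hT hn))

lemma IsParent.reachable_deleteEdges_right (hT : T.IsTree) {a b u : V} (h : IsParent T r b a) :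
    (T.deleteEdges {s(a, b)}).Reachable u b ↔ u ∉ subtree T r a := by
  refine ⟨fun hu hn => ?_, h.reachable_deleteEdges_of_not_mem hT⟩
  exact not_reachable_deleteEdges hT h.adj
    ((h.reachable_deleteEdges_of_mem hT hn).symm.trans hu)

/-- In the tree `T`, the paths from `v` and from `y` to the node `r` are such that the first one
uses the directed edge `(a, b)` and the second one does not. -/
def UsesEdge (T : SimpleGraph V) (v y r a b : V) : Prop :=
  T.Adj a b ∧ (T.deleteEdges {s(a, b)}).Reachable v a ∧
    (T.deleteEdges {s(a, b)}).Reachable y b ∧ (T.deleteEdges {s(a, b)}).Reachable r b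

lemma usesEdge_iff (hT : T.IsTree) {v y a b : V} :
    UsesEdge T v y r a b ↔ IsParent T r b a ∧ v ∈ subtree T r a ∧ y ∉ subtree T r a := by
  constructor
  · rintro ⟨hab, hv, hy, hr⟩
    rcases isParent_or_isParent (r := r) hT hab with h | h
    · exact ⟨h, (h.reachable_deleteEdges_left hT).1 hv, (h.reachable_deleteEdges_right hT).1 hy⟩
    · rw [Sym2.eq_swap] at hr
      exact absurd (root_mem_subtree_iff.1 ((h.reachable_deleteEdges_left hT).1 hr)) h.ne_root
  · rintro ⟨h, hv, hy⟩
    exact ⟨h.adj, (h.reachable_deleteEdges_left hT).2 hv, (h.reachable_deleteEdges_right hT).2 hy,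
      (h.reachable_deleteEdges_right hT).2 fun hr => h.ne_root (root_mem_subtree_iff.1 hr)⟩

end RootedTrees

/-- If every call leaves the state as it found it, the calls do not influence one another and the
fold is a plain sum. -/
lemma foldl_restoring {V S : Type*} (f : V → S → ℝ × S) (s : S) (l : List V)
    (h : ∀ c ∈ l, (f c s).2 = s) (a : ℝ) :
    l.foldl (fun st c => (st.1 + (f c st.2).1, (f c st.2).2)) (a, s) =
      (a + (l.map fun c => (f c s).1).sum, s) := by
  induction l generalizing a with
  | nil => simp
  | cons c l ih =>
    rw [List.foldl_cons]
    simp only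
    rw [h c (by simp), ih (fun d hd => h d (by simp [hd]))]
    simp [add_assoc]

/-! ### Closed form of the value returned by the depth-first search. -/

section AlgorithmValue

variable {V : Type*} [Fintype V] [DecidableEq V] (G : SimpleGraph V) [DecidableRel G.Adj]

open scoped Classical in
/-- The amount that entering `w` adds to the entry `u` of the array. -/
noncomputable def increment (T T₀ : SimpleGraph V) (r w u : V) : ℝ :=
  if IsParent T₀ r (parent T r w) w then
    if u ∈ subtree T₀ r w then 2 * (G.edgeFinset.card : ℝ) - vol G (subtree T r w) else 0
  else if IsParent T₀ r w (parent T r w) then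
    if u ∈ subtree T₀ r (parent T r w) then
      vol G (subtree T r w) - 2 * (G.edgeFinset.card : ℝ) else 0
  else 0

lemma enter_eq (T T₀ : SimpleGraph V) (r w : V) (s : V → ℝ) :
    enter G T T₀ r w s = fun u => s u + increment G T T₀ r w u := by
  funext u
  unfold enter increment rangeAdd
  split_ifs <;> simp_all

lemma leave_enter (T T₀ : SimpleGraph V) (r w : V) (s : V → ℝ) :
    leave G T T₀ r w (enter G T T₀ r w s) = s := by
  funext u
  unfold enter leave rangeAdd
  split_ifs <;> simp only <;> split_ifs <;> ring

open scoped Classical in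
/-- The value of the call `DFS(v, T, T₀)` on the array `s`. -/
noncomputable def dfsValue (T T₀ : SimpleGraph V) (r v : V) (s : V → ℝ) : ℝ :=
  ∑ u with u ∈ subtree T r v, (G.degree u : ℝ) *
    (s u + ∑ w with w ∈ subtree T r v ∧ u ∈ subtree T r w, increment G T T₀ r w u)

-- The recursion of `dfs`: a node u below the child c has as its ancestors in the subtree of v
-- exactly v and its ancestors in the subtree of c, so the increment of v can be moved into the
-- array.
open scoped Classical in
lemma dfsValue_eq {T : SimpleGraph V} (hT : T.IsTree) (T₀ : SimpleGraph V) (r v : V)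
    (s : V → ℝ) :
    dfsValue G T T₀ r v s = (G.degree v : ℝ) * enter G T T₀ r v s v +
      ∑ c with IsParent T r v c, dfsValue G T T₀ r c (enter G T T₀ r v s) := by
  have hsub : (Finset.univ.filter fun u => u ∈ subtree T r v) =
      insert v ((Finset.univ.filter fun c => IsParent T r v c).biUnion
        fun c => Finset.univ.filter fun u => u ∈ subtree T r c) := by
    ext u
    simp [mem_subtree_iff_exists_child hT (u := u) (v := v)]
  unfold dfsValue
  rw [hsub, Finset.sum_insert, Finset.sum_biUnion]
  · congr 1
    · congr 1
      rw [enter_eq]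
      congr 1
      rw [← Finset.sum_singleton (fun w => increment G T T₀ r w v) v]
      refine Finset.sum_congr ?_ fun _ _ => rfl
      ext w
      simp only [Finset.mem_filter_univ, Finset.mem_singleton]
      constructor
      · rintro ⟨h1, h2⟩
        exact subtree_antisymm hT h1 h2
      · rintro rfl
        exact ⟨mem_subtree_self hT _, mem_subtree_self hT _⟩
    · refine Finset.sum_congr rfl fun c hc => Finset.sum_congr rfl fun u hu => ?_
      rw [Finset.mem_filter_univ] at hc hu
      congr 1
      rw [enter_eq, add_assoc]
      congr 1
      have : (Finset.univ.filter fun w => w ∈ subtree T r v ∧ u ∈ subtree T r w) =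
          insert v (Finset.univ.filter fun w => w ∈ subtree T r c ∧ u ∈ subtree T r w) := by
        ext w
        simp only [Finset.mem_filter_univ, Finset.mem_insert]
        constructor
        · rintro ⟨h1, h2⟩
          rcases (mem_subtree_iff_exists_child hT).1 h1 with rfl | ⟨d, hd, hwd⟩
          · exact Or.inl rfl
          · rw [child_unique hT hc hd hu (subtree_trans hT h2 hwd)]
            exact Or.inr ⟨hwd, h2⟩
        · have hcv : c ∈ subtree T r v :=
            (mem_subtree_iff_exists_child hT).2 (Or.inr ⟨c, hc, mem_subtree_self hT c⟩)
          rintro (rfl | ⟨h1, h2⟩)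
          · exact ⟨mem_subtree_self hT _, subtree_trans hT hu hcv⟩
          · exact ⟨subtree_trans hT h1 hcv, h2⟩
      rw [this, Finset.sum_insert]
      simp only [Finset.mem_filter_univ, not_and]
      exact fun h => absurd h (hc.not_mem_subtree hT)
  · intro c hc d hd hcd
    simp only [Finset.coe_filter, Set.mem_ofPred_eq, Finset.mem_univ, true_and] at hc hd
    rw [Function.onFun, Finset.disjoint_filter]
    exact fun u _ h1 h2 => hcd (child_unique hT hc hd h1 h2)
  · simp only [Finset.mem_biUnion, Finset.mem_filter_univ, not_exists, not_and]
    exact fun c hc => hc.not_mem_subtree hT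

lemma dfs_eq {T : SimpleGraph V} (hT : T.IsTree) (T₀ : SimpleGraph V) (r : V) (fuel : ℕ) (v : V)
    (s : V → ℝ) (h : Fintype.card V ≤ fuel + T.dist r v) :
    dfs G T T₀ r fuel v s = (dfsValue G T T₀ r v s, s) := by
  induction fuel generalizing v s with
  | zero =>
    -- Without fuel, v would have depth at least n, but a path has fewer than n edges.
    obtain ⟨q, hq, hl⟩ := hT.connected.exists_path_of_dist r v
    have := hq.length_lt
    omega
  | succ fuel ih =>
    have hc : ∀ c ∈ children T r v, ∀ s, dfs G T T₀ r fuel c s = (dfsValue G T T₀ r c s, s) := by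
      intro c hc s
      refine ih c s ?_
      have : IsParent T r v c := by simpa [children] using hc
      have := this.2
      omega
    rw [dfs]
    simp only
    rw [foldl_restoring (fun c st => dfs G T T₀ r fuel c st) _ _ (fun c h => by rw [hc c h])]
    simp only [leave_enter, Prod.mk.injEq, and_true]
    rw [dfsValue_eq G hT]
    congr 1
    rw [List.map_congr_left (fun c h => by rw [hc c h])]
    simp [children]

open scoped Classical in
/-- The value of the call `DFS(r, T, T₀)` at the root, on the array that vanishes. -/
noncomputable def sampleValue (T T₀ : SimpleGraph V) (r : V) : ℝ :=
  ∑ u, (G.degree u : ℝ) * ∑ w with u ∈ subtree T r w, increment G T T₀ r w u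

open scoped Classical in
lemma dfs_root {T : SimpleGraph V} (hT : T.IsTree) (T₀ : SimpleGraph V) (r : V) :
    dfs G T T₀ r (Fintype.card V) r (fun _ => 0) = (sampleValue G T T₀ r, fun _ => 0) := by
  rw [dfs_eq G hT _ _ _ _ _ (by simp)]
  unfold dfsValue sampleValue
  rw [Finset.filter_true_of_mem (p := fun u => u ∈ subtree T r r)
    fun u _ => mem_subtree_root hT u]
  simp only [zero_add, mem_subtree_root hT, true_and]

lemma ttf_eq (r : V) (T₀ : SpanningTree G) {ω : ℕ} (τ : Fin ω → SpanningTree G) :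
    ttf G r T₀ τ = (∑ k, sampleValue G (τ k).1 T₀.1 r) / (2 * (G.edgeFinset.card : ℝ) * (ω : ℝ)) := by
  have key : ∀ (l : List (SpanningTree G)) (a : ℝ),
      l.foldl (fun st T =>
        let res := dfs G T.1 T₀.1 r (Fintype.card V) r st.2
        (st.1 + res.1, res.2)) (a, fun _ : V => (0 : ℝ)) =
      (a + (l.map fun T => sampleValue G T.1 T₀.1 r).sum, fun _ => 0) := by
    intro l
    induction l with
    | nil => simp
    | cons T l ih =>
      intro a
      rw [List.foldl_cons]
      simp only at ih ⊢
      rw [dfs_root G T.2.2, ih]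
      simp [add_assoc]
  rw [ttf, key, List.map_ofFn, List.sum_ofFn]
  simp

-- Regroups the increments by edges (a, b) of `T₀`, directed to the root: the node w of `T` that
-- triggers the update is a if `T` directs the edge in the same way, and b, with a minus sign, if
-- `T` reverses it.
open scoped Classical in
lemma sampleValue_eq {T T₀ : SimpleGraph V} (hT : T.IsTree) (r : V) :
    sampleValue G T T₀ r = ∑ v, (G.degree v : ℝ) * ∑ a, ∑ b,
      if IsParent T₀ r b a ∧ v ∈ subtree T₀ r a then
        (if IsParent T r b a ∧ v ∈ subtree T r a then
          2 * (G.edgeFinset.card : ℝ) - vol G (subtree T r a) else 0) -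
        (if IsParent T r a b ∧ v ∈ subtree T r b then
          2 * (G.edgeFinset.card : ℝ) - vol G (subtree T r b) else 0)
      else 0 := by
  unfold sampleValue
  refine Finset.sum_congr rfl fun v _ => ?_
  congr 1
  have hsplit : ∀ w, (if v ∈ subtree T r w then increment G T T₀ r w v else 0) =
      (∑ b, if IsParent T₀ r b w ∧ v ∈ subtree T₀ r w ∧ IsParent T r b w ∧ v ∈ subtree T r w then
          2 * (G.edgeFinset.card : ℝ) - vol G (subtree T r w) else 0) -
      ∑ a, if IsParent T₀ r w a ∧ v ∈ subtree T₀ r a ∧ IsParent T r a w ∧ v ∈ subtree T r w then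
          2 * (G.edgeFinset.card : ℝ) - vol G (subtree T r w) else 0 := by
    intro w
    by_cases hw : w = r
    · subst hw
      simp [increment, parent_root, not_isParent_root]
    · have hp := isParent_parent hT hw
      have huniq : ∀ b, IsParent T r b w ↔ b = parent T r w :=
        fun b => ⟨fun h => h.unique hT hp, fun h => h ▸ hp⟩
      rw [Finset.sum_eq_single (parent T r w), Finset.sum_eq_single (parent T r w)]
      · unfold increment
        have := fun h : IsParent T₀ r (parent T r w) w => h.asymm
        split_ifs <;> simp_all
      all_goals simp +contextual [huniq]
  rw [Finset.sum_filter, Finset.sum_congr rfl fun w _ => hsplit w, Finset.sum_sub_distrib]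
  conv_lhs => rw [sub_eq_add_neg]; arg 2; rw [Finset.sum_comm]
  rw [← sub_eq_add_neg, ← Finset.sum_sub_distrib]
  refine Finset.sum_congr rfl fun a _ => ?_
  rw [← Finset.sum_sub_distrib]
  refine Finset.sum_congr rfl fun b _ => ?_
  split_ifs <;> simp_all

end AlgorithmValue

/-! ### Spanning trees, 2-forests and the electrical potential. -/

section Forests

variable {V : Type*}

/-- `F` is a spanning forest of `G` with two components, one of which contains `v` and the other
one `y` and `r`. -/
def IsTwoForest (G F : SimpleGraph V) (v y r : V) : Prop :=
  F ≤ G ∧ F.IsAcyclic ∧ F.Reachable y r ∧ ¬ F.Reachable v r ∧ ∀ w, F.Reachable v w ∨ F.Reachable r w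

lemma IsTwoForest.reachable_right_iff {G F : SimpleGraph V} {v y r : V}
    (h : IsTwoForest G F v y r) (w : V) : F.Reachable r w ↔ ¬ F.Reachable v w :=
  ⟨fun hr hv => h.2.2.2.1 (hv.trans hr.symm), (h.2.2.2.2 w).resolve_left⟩

lemma deleteEdges_sup_edge {F : SimpleGraph V} {a b : V} (h : ¬ F.Adj a b) :
    (F ⊔ SimpleGraph.edge a b).deleteEdges {s(a, b)} = F := by
  ext x z
  have h' : ¬ F.Adj b a := fun h' => h h'.symm
  simp only [SimpleGraph.deleteEdges_adj, SimpleGraph.sup_adj, SimpleGraph.edge_adj,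
    Set.mem_singleton_iff, Sym2.eq_iff]
  constructor
  · tauto
  · intro hF
    refine ⟨Or.inl hF, ?_⟩
    rintro (⟨rfl, rfl⟩ | ⟨rfl, rfl⟩) <;> tauto

lemma sup_edge_deleteEdges {T : SimpleGraph V} {a b : V} (h : T.Adj a b) :
    T.deleteEdges {s(a, b)} ⊔ SimpleGraph.edge a b = T := by
  ext x z
  have hs := h.symm
  have hne := h.ne
  simp only [SimpleGraph.deleteEdges_adj, SimpleGraph.sup_adj, SimpleGraph.edge_adj,
    Set.mem_singleton_iff, Sym2.eq_iff]
  constructor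
  · rintro (h1 | ⟨⟨rfl, rfl⟩ | ⟨rfl, rfl⟩, -⟩) <;> tauto
  · intro hT
    have := hT.ne
    tauto

lemma IsTwoForest.isTree_sup_edge {G F : SimpleGraph V} {v y r a b : V}
    (h : IsTwoForest G F v y r) (hab : a ≠ b) (ha : F.Reachable v a) (hb : F.Reachable r b) :
    (F ⊔ SimpleGraph.edge a b).IsTree := by
  have hn : ¬ F.Reachable a b := fun h' => h.2.2.2.1 (ha.trans (h'.trans hb.symm))
  have : Nonempty V := ⟨v⟩
  refine ⟨⟨?_⟩, h.2.1.sup_edge_of_not_reachable hn⟩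
  have hle : F ≤ F ⊔ SimpleGraph.edge a b := le_sup_left
  have hv : ∀ w, (F ⊔ SimpleGraph.edge a b).Reachable v w := by
    intro w
    rcases h.2.2.2.2 w with h' | h'
    · exact h'.mono hle
    · have : (F ⊔ SimpleGraph.edge a b).Adj a b := by simp [SimpleGraph.edge_adj, hab]
      exact (ha.mono hle).trans (this.reachable.trans ((hb.symm.trans h').mono hle))
  exact fun x z => (hv x).symm.trans (hv z)

lemma UsesEdge.isTwoForest {G T : SimpleGraph V} (hG : T ≤ G) (hT : T.IsTree) {v y r a b : V}
    (h : UsesEdge T v y r a b) : IsTwoForest G (T.deleteEdges {s(a, b)}) v y r := by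
  obtain ⟨hp, -, -⟩ := (usesEdge_iff hT).1 h
  obtain ⟨hab, hv, hy, hr⟩ := h
  refine ⟨(SimpleGraph.deleteEdges_le _).trans hG, hT.isAcyclic.anti (SimpleGraph.deleteEdges_le _),
    hy.trans hr.symm, fun hvr => not_reachable_deleteEdges hT hab (hv.symm.trans (hvr.trans hr)),
    fun w => ?_⟩
  by_cases hw : w ∈ subtree T r a
  · exact Or.inl (hv.trans ((hp.reachable_deleteEdges_left hT).2 hw).symm)
  · exact Or.inr (hr.trans ((hp.reachable_deleteEdges_right hT).2 hw).symm)

variable [Fintype V] [DecidableEq V] (G : SimpleGraph V) [DecidableRel G.Adj]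

open scoped Classical in
/-- The finite set of spanning trees of `G`. -/
noncomputable def trees : Finset (SimpleGraph V) := {T | T ≤ G ∧ T.IsTree}

lemma mem_trees {T : SimpleGraph V} : T ∈ trees G ↔ T ≤ G ∧ T.IsTree := by
  simp [trees]

open scoped Classical in
/-- The number of spanning forests of `G` with two components, one of which contains `v` and `a`
and the other one `y` and `r`. -/
noncomputable def forestCount (v y r a : V) : ℝ :=
  ((Finset.univ.filter fun F => IsTwoForest G F v y r ∧ F.Reachable v a).card : ℝ)

variable {G}

-- Deleting the edge from the tree and adding it back to the forest are inverse bijections.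
open scoped Classical in
lemma card_usesEdge {v y r a b : V} (hab : G.Adj a b) :
    ((trees G).filter fun T => UsesEdge T v y r a b).card =
      (Finset.univ.filter fun F => (IsTwoForest G F v y r ∧ F.Reachable v a) ∧
        ¬ F.Reachable v b).card := by
  refine Finset.card_nbij' (fun T => T.deleteEdges {s(a, b)}) (fun F => F ⊔ SimpleGraph.edge a b)
    ?_ ?_ ?_ ?_
  · intro T hT
    simp only [Finset.coe_filter, mem_trees, Set.mem_ofPred_eq, Finset.mem_univ, true_and] at hT ⊢
    obtain ⟨⟨hG, hT⟩, hu⟩ := hT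
    have hF := hu.isTwoForest hG hT
    exact ⟨⟨hF, hu.2.1⟩, (hF.reachable_right_iff b).1 hu.2.2.2⟩
  · intro F hF
    simp only [Finset.coe_filter, mem_trees, Set.mem_ofPred_eq, Finset.mem_univ, true_and] at hF ⊢
    obtain ⟨⟨hF, ha⟩, hb⟩ := hF
    rw [← hF.reachable_right_iff] at hb
    have hn : ¬ F.Adj a b := fun h => hF.2.2.2.1 (ha.trans (h.reachable.trans hb.symm))
    refine ⟨⟨sup_le hF.1 ?_, hF.isTree_sup_edge hab.ne ha hb⟩, ?_, ?_⟩
    · rw [SimpleGraph.edge_le_iff]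
      exact Or.inr hab
    · simp [SimpleGraph.edge_adj, hab.ne]
    · rw [deleteEdges_sup_edge hn]
      exact ⟨ha, hF.2.2.1.trans hb, hb⟩
  · intro T hT
    simp only [Finset.coe_filter, mem_trees, Set.mem_ofPred_eq] at hT
    exact sup_edge_deleteEdges hT.2.1
  · intro F hF
    simp only [Finset.coe_filter, Set.mem_ofPred_eq, Finset.mem_univ, true_and] at hF
    obtain ⟨⟨hF, ha⟩, hb⟩ := hF
    rw [← hF.reachable_right_iff] at hb
    exact deleteEdges_sup_edge fun h => hF.2.2.2.1 (ha.trans (h.reachable.trans hb.symm))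

open scoped Classical in
/-- The net number of spanning trees that use an edge is a difference of potentials. -/
lemma sum_usesEdge {a b : V} (v y r : V) (hab : G.Adj a b) :
    ∑ T ∈ trees G, ((if UsesEdge T v y r a b then 1 else 0) -
      (if UsesEdge T v y r b a then 1 else 0) : ℝ) =
        forestCount G v y r a - forestCount G v y r b := by
  rw [Finset.sum_sub_distrib, Finset.sum_boole, Finset.sum_boole, card_usesEdge hab,
    card_usesEdge hab.symm]
  unfold forestCount
  -- Forests in which v reaches both a and b are counted by both potentials; they cancel in the
  -- difference.
  rw [← Finset.card_filter_add_card_filter_not (s := Finset.univ.filter fun F =>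
      IsTwoForest G F v y r ∧ F.Reachable v a) (fun F => F.Reachable v b),
    ← Finset.card_filter_add_card_filter_not (s := Finset.univ.filter fun F =>
      IsTwoForest G F v y r ∧ F.Reachable v b) (fun F => F.Reachable v a)]
  simp only [Finset.filter_filter, Nat.cast_add]
  simp only [and_assoc, and_comm (a := SimpleGraph.Reachable _ v b)]
  ring_nf

open scoped Classical in
lemma forestCount_right (v y r : V) : forestCount G v y r r = 0 := by
  simp only [forestCount, Nat.cast_eq_zero, Finset.card_eq_zero]
  exact Finset.filter_eq_empty_iff.2 fun F _ h => h.1.2.2.2.1 h.2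

lemma forestCount_nonneg (v y r a : V) : 0 ≤ forestCount G v y r a := Nat.cast_nonneg _

-- Both sides count the forests that separate v from y and r; only the component that is named first
-- changes. This turns the potential with sink r, evaluated at v, into the one grounded at v,
-- evaluated at r.
open scoped Classical in
lemma forestCount_swap (v y r : V) : forestCount G v y r v = forestCount G y v v r := by
  unfold forestCount
  congr 2
  refine Finset.filter_congr fun F _ => ?_
  constructor
  · rintro ⟨⟨h1, h2, h3, h4, h5⟩, -⟩
    refine ⟨⟨h1, h2, SimpleGraph.Reachable.refl _, fun h => h4 (h.symm.trans h3), fun w => ?_⟩, h3⟩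
    exact (h5 w).symm.imp_left h3.trans
  · rintro ⟨⟨h1, h2, h3, h4, h5⟩, h6⟩
    refine ⟨⟨h1, h2, h6, fun h => h4 (h6.trans h.symm), fun w => ?_⟩, SimpleGraph.Reachable.refl _⟩
    exact (h5 w).symm.imp_right h6.symm.trans

-- Telescoping along the tree path from v to the root.
open scoped Classical in
lemma sum_path_sub {T : SimpleGraph V} (hT : T.IsTree) (r : V) (φ : V → ℝ) (v : V) :
    (∑ a, ∑ b, if IsParent T r b a ∧ v ∈ subtree T r a then φ a - φ b else 0) = φ v - φ r := by
  induction v using parent_induction hT (r := r) with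
  | root =>
    simp only [root_mem_subtree_iff, sub_self]
    refine Finset.sum_eq_zero fun a _ => Finset.sum_eq_zero fun b _ => if_neg ?_
    rintro ⟨h, rfl⟩
    exact h.ne_root rfl
  | step p v hp ih =>
    have hsplit : ∀ a, (∑ b, if IsParent T r b a ∧ v ∈ subtree T r a then φ a - φ b else 0) =
        (if a = v then φ v - φ p else 0) +
          ∑ b, if IsParent T r b a ∧ p ∈ subtree T r a then φ a - φ b else 0 := by
      intro a
      by_cases ha : a = v
      · subst ha
        rw [Finset.sum_eq_single p]
        · simp [hp, hp.not_mem_subtree hT, mem_subtree_self hT]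
        · intro b _ hb
          exact if_neg fun h => hb (h.1.unique hT hp)
        · simp
      · rw [if_neg ha, zero_add]
        simp only [hp.mem_subtree_iff hT a, Ne.symm ha, false_or]
    rw [Finset.sum_congr rfl fun a _ => hsplit a, Finset.sum_add_distrib, ih,
      Finset.sum_ite_eq' Finset.univ v fun _ => φ v - φ p]
    simp

-- Kirchhoff's current law for the unit flow along the tree path from y to v: away from the sink v,
-- the net outflow is 1 at the source y and 0 elsewhere.
open scoped Classical in
lemma sum_usesEdge_of_tree {T : SimpleGraph V} (hT : T.IsTree) {v w : V} (hw : w ≠ v) (y : V) :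
    (∑ z, ((if UsesEdge T y v v w z then 1 else 0) -
      (if UsesEdge T y v v z w then 1 else 0) : ℝ)) = if y = w then 1 else 0 := by
  have h : ∀ a b, UsesEdge T y v v a b ↔ IsParent T v b a ∧ y ∈ subtree T v a := by
    intro a b
    rw [usesEdge_iff hT]
    have := fun h : IsParent T v b a => h.ne_root
    rw [root_mem_subtree_iff]
    exact ⟨fun h => ⟨h.1, h.2.1⟩, fun h => ⟨h.1, h.2, this h.1⟩⟩
  simp only [h]
  have h1 : (∑ z, if IsParent T v z w ∧ y ∈ subtree T v w then (1 : ℝ) else 0) =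
      if y ∈ subtree T v w then 1 else 0 := by
    rw [Finset.sum_eq_single (parent T v w)]
    · simp [isParent_parent hT hw]
    · exact fun b _ hb => if_neg fun h => hb (h.1.unique hT (isParent_parent hT hw))
    · simp
  rw [Finset.sum_sub_distrib, h1]
  by_cases hy : y ∈ subtree T v w
  · rw [if_pos hy]
    rcases (mem_subtree_iff_exists_child hT).1 hy with rfl | ⟨c, hc, hyc⟩
    · rw [Finset.sum_eq_zero, if_pos rfl, sub_zero]
      exact fun c _ => if_neg fun hc => hc.1.not_mem_subtree hT hc.2
    · rw [Finset.sum_eq_single c, if_pos ⟨hc, hyc⟩, if_neg, sub_self]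
      · rintro rfl
        exact hc.not_mem_subtree hT hyc
      · exact fun d _ hd => if_neg fun h => hd (child_unique hT h.1 hc h.2 hyc)
      · simp
  · rw [if_neg hy, if_neg, Finset.sum_eq_zero, sub_zero]
    · exact fun c _ => if_neg fun h => hy ((mem_subtree_iff_exists_child hT).2 (Or.inr ⟨c, h⟩))
    · rintro rfl
      exact hy (mem_subtree_self hT _)

open scoped Classical in
lemma sum_adj_forestCount {v w : V} (hw : w ≠ v) (y : V) :
    (∑ z, if G.Adj w z then forestCount G y v v w - forestCount G y v v z else 0) =
      if y = w then ((trees G).card : ℝ) else 0 := by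
  have : ∀ z, (if G.Adj w z then forestCount G y v v w - forestCount G y v v z else 0) =
      ∑ T ∈ trees G, ((if UsesEdge T y v v w z then 1 else 0) -
        (if UsesEdge T y v v z w then 1 else 0) : ℝ) := by
    intro z
    split_ifs with h
    · rw [sum_usesEdge y v v h]
    · refine (Finset.sum_eq_zero fun T hT => ?_).symm
      rw [mem_trees] at hT
      rw [if_neg fun h' => h (hT.1 h'.1), if_neg fun h' => h (hT.1 h'.1.symm), sub_self]
  rw [Finset.sum_congr rfl fun z _ => this z, Finset.sum_comm,
    Finset.sum_congr rfl fun T hT => sum_usesEdge_of_tree ((mem_trees G).1 hT).2 hw y]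
  simp

/-- The potential of the network in which every node injects its degree and `v` is grounded. -/
noncomputable def potential (G : SimpleGraph V) [DecidableRel G.Adj] (v w : V) : ℝ :=
  (∑ y, (G.degree y : ℝ) * forestCount G y v v w) / ((trees G).card : ℝ)

lemma potential_self (v : V) : potential G v v = 0 := by
  simp [potential, forestCount_right]

lemma potential_nonneg (v w : V) : 0 ≤ potential G v w :=
  div_nonneg (Finset.sum_nonneg fun _ _ => mul_nonneg (Nat.cast_nonneg _)
    (forestCount_nonneg _ _ _ _)) (Nat.cast_nonneg _)

open scoped Classical in
lemma card_trees_pos (hG : G.Connected) : 0 < ((trees G).card : ℝ) := by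
  obtain ⟨T, hT⟩ := hG.exists_isTree_le
  exact Nat.cast_pos.2 (Finset.card_pos.2 ⟨T, (mem_trees G).2 hT⟩)

/-- This is d(w) times the hitting-time equation h(w) = 1 + (Ph)(w) for the target v. -/
lemma sum_adj_potential (hG : G.Connected) {v w : V} (hw : w ≠ v) :
    (∑ z, if G.Adj w z then potential G v w - potential G v z else 0) = G.degree w := by
  have hN := (card_trees_pos hG).ne'
  have : ∀ z, (if G.Adj w z then potential G v w - potential G v z else 0) =
      (∑ y, (G.degree y : ℝ) *
        if G.Adj w z then forestCount G y v v w - forestCount G y v v z else 0) /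
          ((trees G).card : ℝ) := by
    intro z
    split_ifs
    · simp only [potential, mul_sub, Finset.sum_sub_distrib, sub_div]
    · simp
  rw [Finset.sum_congr rfl fun z _ => this z, ← Finset.sum_div, Finset.sum_comm]
  simp only [← Finset.mul_sum, sum_adj_forestCount hw]
  simp [hN]

lemma sum_degree_eq : ∑ v, (G.degree v : ℝ) = 2 * (G.edgeFinset.card : ℝ) := by
  exact_mod_cast G.sum_degrees_eq_twice_card_edges

open scoped Classical in
lemma sub_vol_eq (S : Set V) : 2 * (G.edgeFinset.card : ℝ) - vol G S =
    ∑ y, (G.degree y : ℝ) * if y ∉ S then 1 else 0 := by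
  rw [← sum_degree_eq, vol, ← Finset.sum_filter_add_sum_filter_not Finset.univ (fun y => y ∈ S)]
  rw [add_sub_cancel_left, Finset.sum_filter]
  simp

open scoped Classical in
lemma sampleValue_eq_sum_usesEdge {T T₀ : SimpleGraph V} (hT : T.IsTree) (r : V) :
    sampleValue G T T₀ r = ∑ v, (G.degree v : ℝ) * ∑ y, (G.degree y : ℝ) * ∑ a, ∑ b,
      if IsParent T₀ r b a ∧ v ∈ subtree T₀ r a then
        ((if UsesEdge T v y r a b then 1 else 0) - (if UsesEdge T v y r b a then 1 else 0) : ℝ)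
      else 0 := by
  have h1 : ∀ v a b, (if IsParent T r b a ∧ v ∈ subtree T r a then
      2 * (G.edgeFinset.card : ℝ) - vol G (subtree T r a) else 0) =
      ∑ y, (G.degree y : ℝ) * if UsesEdge T v y r a b then 1 else 0 := by
    intro v a b
    simp only [usesEdge_iff hT, sub_vol_eq]
    by_cases h : IsParent T r b a ∧ v ∈ subtree T r a
    · simp [h]
    · rw [if_neg h]
      refine (Finset.sum_eq_zero fun y _ => ?_).symm
      rw [if_neg (by tauto), mul_zero]
  rw [sampleValue_eq G hT]
  refine Finset.sum_congr rfl fun v _ => ?_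
  congr 1
  simp only [Finset.mul_sum]
  conv_rhs => rw [Finset.sum_comm]
  refine Finset.sum_congr rfl fun a _ => ?_
  conv_rhs => rw [Finset.sum_comm]
  refine Finset.sum_congr rfl fun b _ => ?_
  rw [h1, h1, ← Finset.sum_sub_distrib]
  split_ifs
  · exact Finset.sum_congr rfl fun y _ => by ring
  · simp

/-- Unbiasedness up to normalisation. For fixed v and y the net edge counts are potential
differences, which telescope along `T₀`, whatever spanning tree it is. -/
lemma sum_sampleValue {T₀ : SimpleGraph V} (hG : G.Connected) (h₀ : T₀ ≤ G) (hT₀ : T₀.IsTree)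
    (r : V) : ∑ T ∈ trees G, sampleValue G T T₀ r =
      ((trees G).card : ℝ) * ∑ v, (G.degree v : ℝ) * potential G v r := by
  classical
  have hN := (card_trees_pos hG).ne'
  rw [Finset.sum_congr rfl fun T hT => sampleValue_eq_sum_usesEdge (G := G) ((mem_trees G).1 hT).2 r,
    Finset.sum_comm, Finset.mul_sum]
  refine Finset.sum_congr rfl fun v _ => ?_
  rw [← Finset.mul_sum, Finset.sum_comm, mul_left_comm]
  congr 1
  rw [potential, mul_div_cancel₀ _ hN]
  refine Finset.sum_congr rfl fun y _ => ?_
  rw [← Finset.mul_sum, Finset.sum_comm]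
  congr 1
  have hφ : forestCount G y v v r = forestCount G v y r v - forestCount G v y r r := by
    rw [forestCount_right, sub_zero, forestCount_swap]
  rw [hφ, ← sum_path_sub hT₀ r]
  refine Finset.sum_congr rfl fun a _ => ?_
  rw [Finset.sum_comm]
  refine Finset.sum_congr rfl fun b _ => ?_
  split_ifs with h
  · exact sum_usesEdge v y r (h₀ h.1.adj)
  · simp

end Forests

/-! ### Potentials as hitting times of the random walk. -/

section HittingTimes

variable {V : Type*} [Fintype V] [DecidableEq V] {G : SimpleGraph V} [DecidableRel G.Adj]

lemma transition_nonneg (i j : V) : 0 ≤ transition G i j := by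
  unfold transition
  rw [SimpleGraph.adjMatrix_apply]
  split_ifs <;> positivity

lemma avoidProb_nonneg (i j : V) (k : ℕ) : 0 ≤ avoidProb G i j k :=
  Finset.sum_nonneg fun _ _ => Finset.prod_nonneg fun _ _ => transition_nonneg _ _

lemma avoidProb_zero (i j : V) : avoidProb G i j 0 = if i = j then 0 else 1 := by
  unfold avoidProb
  rw [Finset.sum_filter, ← (Equiv.funUnique (Fin 1) V).symm.sum_comp]
  simp only [Finset.univ_eq_empty, Finset.prod_empty]
  rw [Finset.sum_eq_single i]
  · by_cases h : i = j <;> simp [h, Equiv.funUnique]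
  · intro b _ hb
    simp [hb]
  · simp

lemma avoidProb_self (j : V) (k : ℕ) : avoidProb G j j k = 0 := by
  unfold avoidProb
  rw [Finset.filter_false_of_mem, Finset.sum_empty]
  exact fun x _ h => h.2 0 h.1

lemma avoidProb_succ {i j : V} (hij : i ≠ j) (k : ℕ) :
    avoidProb G i j (k + 1) = ∑ l, transition G i l * avoidProb G l j k := by
  have hr : ∀ l, transition G i l * avoidProb G l j k = ∑ x : Fin (k + 1) → V,
      if x 0 = l then (if ∀ s, x s ≠ j then transition G i (x 0) *
        ∏ s : Fin k, transition G (x s.castSucc) (x s.succ) else 0) else 0 := by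
    intro l
    unfold avoidProb
    rw [Finset.mul_sum, Finset.sum_filter]
    refine Finset.sum_congr rfl fun x _ => ?_
    by_cases h : x 0 = l
    · by_cases h' : ∀ s, x s ≠ j
      · rw [if_pos ⟨h, h'⟩, if_pos h, if_pos h', h]
      · rw [if_neg (fun h'' => h' h''.2), if_pos h, if_neg h']
    · rw [if_neg (fun h'' => h h''.1), if_neg h]
  rw [Finset.sum_congr rfl fun l _ => hr l, Finset.sum_comm]
  simp only [Finset.sum_ite_eq, Finset.mem_univ, if_true]
  unfold avoidProb
  rw [Finset.sum_filter, ← (Fin.consEquiv fun _ => V).sum_comp, Fintype.sum_prod_type,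
    Finset.sum_eq_single i]
  · refine Finset.sum_congr rfl fun x _ => ?_
    simp only [Fin.consEquiv_apply, Fin.cons_zero, true_and, Fin.forall_fin_succ (n := k + 1),
      Fin.cons_succ, Fin.prod_univ_succ (n := k), Fin.castSucc_zero, ← Fin.succ_castSucc]
    simp [hij]
  · intro b _ hb
    refine Finset.sum_eq_zero fun x _ => if_neg fun h => hb ?_
    simpa [Fin.consEquiv] using h.1
  · simp

lemma degree_pos' [Nontrivial V] (hG : G.Connected) (v : V) : 0 < (G.degree v : ℝ) :=
  Nat.cast_pos.2 (hG.preconnected.degree_pos_of_nontrivial v)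

lemma sum_transition_mul [Nontrivial V] (hG : G.Connected) (f : V → ℝ) (i : V) :
    ∑ l, transition G i l * f l =
      f i - (∑ l, if G.Adj i l then f i - f l else 0) / G.degree i := by
  have hd := (degree_pos' hG i).ne'
  have h1 : (∑ l, if G.Adj i l then f i - f l else 0) =
      G.degree i * f i - ∑ l, if G.Adj i l then f l else 0 := by
    rw [SimpleGraph.degree_eq_sum_if_adj, Finset.sum_mul, ← Finset.sum_sub_distrib]
    refine Finset.sum_congr rfl fun l _ => ?_
    split_ifs <;> simp
  rw [h1, sub_div, mul_div_cancel_left₀ _ hd, sub_sub_cancel, Finset.sum_div]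
  refine Finset.sum_congr rfl fun l _ => ?_
  rw [transition, SimpleGraph.adjMatrix_apply]
  split_ifs <;> simp [div_eq_inv_mul]

lemma potential_eq [Nontrivial V] (hG : G.Connected) {i j : V} (hij : i ≠ j) :
    potential G j i = 1 + ∑ l, transition G i l * potential G j l := by
  rw [sum_transition_mul hG, sum_adj_potential hG hij, div_self (degree_pos' hG i).ne']
  ring

/-- Iterating h = 1 + Ph off the target N times leaves as remainder the expectation of h at time N
on the event that j has not yet been hit. It lies between 0 and C times the probability of that
event. -/
lemma potential_sub_sum_avoidProb_mem [Nontrivial V] (hG : G.Connected) {C : ℝ} {j : V}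
    (hC : ∀ i, potential G j i ≤ C) (N : ℕ) (i : V) :
    potential G j i - ∑ k ∈ Finset.range N, avoidProb G i j k ∈
      Set.Icc 0 (C * avoidProb G i j N) := by
  by_cases hij : i = j
  · subst hij
    simp [potential_self, avoidProb_self]
  induction N generalizing i with
  | zero => simp [potential_nonneg, hC, avoidProb_zero, hij]
  | succ N ih =>
    have ih' : ∀ l, potential G j l - ∑ k ∈ Finset.range N, avoidProb G l j k ∈
        Set.Icc 0 (C * avoidProb G l j N) := by
      intro l
      by_cases hl : l = j
      · subst hl
        simp [potential_self, avoidProb_self]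
      · exact ih l hl
    have key : potential G j i - ∑ k ∈ Finset.range (N + 1), avoidProb G i j k =
        ∑ l, transition G i l *
          (potential G j l - ∑ k ∈ Finset.range N, avoidProb G l j k) := by
      rw [Finset.sum_range_succ', avoidProb_zero, if_neg hij, potential_eq hG hij]
      simp only [avoidProb_succ hij, mul_sub, Finset.sum_sub_distrib, Finset.mul_sum]
      rw [Finset.sum_comm]
      ring
    rw [key]
    refine ⟨Finset.sum_nonneg fun l _ => mul_nonneg (transition_nonneg _ _) (ih' l).1, ?_⟩
    rw [avoidProb_succ hij, Finset.mul_sum]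
    refine Finset.sum_le_sum fun l _ => ?_
    calc _ ≤ transition G i l * (C * avoidProb G l j N) :=
          mul_le_mul_of_nonneg_left (ih' l).2 (transition_nonneg _ _)
      _ = _ := by ring

/-- Nonnegative remainders bound the partial sums, so the series converges and its terms tend to 0;
the upper bound on the remainder then tends to 0 as well. -/
lemma hasSum_avoidProb [Nontrivial V] (hG : G.Connected) (i j : V) :
    HasSum (avoidProb G i j) (potential G j i) := by
  have hC : ∀ i, potential G j i ≤ ∑ i, potential G j i := fun i =>
    Finset.single_le_sum (fun i _ => potential_nonneg j i) (Finset.mem_univ i)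
  have hmem := fun N => potential_sub_sum_avoidProb_mem hG hC N i
  have hs : Summable (avoidProb G i j) :=
    summable_of_sum_range_le (fun k => avoidProb_nonneg i j k) fun N => sub_nonneg.1 (hmem N).1
  rw [hasSum_iff_tendsto_nat_of_nonneg fun k => avoidProb_nonneg i j k]
  have h0 := squeeze_zero (fun N => (hmem N).1) (fun N => (hmem N).2)
    (by simpa using hs.tendsto_atTop_zero.const_mul (∑ i, potential G j i))
  simpa using h0.const_sub (potential G j i)

/-- The hitting times of the random walk are the potentials of the network. -/
lemma toReal_hittingTime [Nontrivial V] (hG : G.Connected) (i j : V) :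
    (hittingTime G i j).toReal = potential G j i := by
  have h := hasSum_avoidProb hG i j
  rw [hittingTime, ← ENNReal.ofReal_tsum_of_nonneg (fun k => avoidProb_nonneg i j k) h.summable,
    h.tsum_eq, ENNReal.toReal_ofReal (potential_nonneg j i)]

lemma kemeny_eq [Nontrivial V] (hG : G.Connected) (i : V) :
    kemeny G i = (∑ j, (G.degree j : ℝ) * potential G j i) / (2 * (G.edgeFinset.card : ℝ)) := by
  simp only [kemeny, stationary, toReal_hittingTime hG, Finset.sum_div]
  exact Finset.sum_congr rfl fun j _ => by ring

lemma edges_pos [Nontrivial V] (hG : G.Connected) : 0 < 2 * (G.edgeFinset.card : ℝ) := by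
  rw [← sum_degree_eq]
  exact Finset.sum_pos (fun v _ => degree_pos' hG v) Finset.univ_nonempty

/-! ### Laplacian, Dirichlet form and the lower bound for κ. -/

lemma sum_sum_adj_sub (f : V → ℝ) :
    ∑ w, ∑ z, (if G.Adj w z then f w - f z else 0) = 0 := by
  have h : ∑ w, ∑ z, (if G.Adj w z then f w - f z else 0) =
      -∑ w, ∑ z, (if G.Adj w z then f w - f z else 0) := by
    conv_lhs => rw [Finset.sum_comm]
    rw [← Finset.sum_neg_distrib]
    refine Finset.sum_congr rfl fun w _ => ?_
    rw [← Finset.sum_neg_distrib]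
    refine Finset.sum_congr rfl fun z _ => ?_
    simp only [G.adj_comm z w]
    split_ifs <;> simp
  linarith

/-- The Laplacian of any function sums to 0 over the nodes, which fixes its value at v from those
elsewhere. -/
lemma sum_adj_potential_self (hG : G.Connected) (v : V) :
    (∑ z, if G.Adj v z then potential G v v - potential G v z else 0) =
      G.degree v - 2 * (G.edgeFinset.card : ℝ) := by
  have h := sum_sum_adj_sub (G := G) (potential G v)
  rw [← Finset.add_sum_erase _ _ (Finset.mem_univ v),
    Finset.sum_congr rfl fun w hw => sum_adj_potential hG (Finset.ne_of_mem_erase hw)] at h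
  have h' := Finset.add_sum_erase _ (fun w => (G.degree w : ℝ)) (Finset.mem_univ v)
  rw [sum_degree_eq] at h'
  linarith

lemma eq_of_sum_adj_sub_eq_zero (hG : G.Connected) {f : V → ℝ}
    (hf : ∀ w, (∑ z, if G.Adj w z then f w - f z else 0) = 0) (i j : V) : f i = f j := by
  refine (G.lapMatrix_mulVec_eq_zero_iff_forall_reachable.1 ?_) i j (hG.preconnected i j)
  ext w
  rw [SimpleGraph.lapMatrix_mulVec_apply, Pi.zero_apply, ← hf w,
    SimpleGraph.degree_eq_sum_if_adj, Finset.sum_mul, SimpleGraph.neighborFinset_eq_filter,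
    Finset.sum_filter, ← Finset.sum_sub_distrib]
  refine Finset.sum_congr rfl fun l _ => ?_
  split_ifs <;> simp

/-- The Kemeny constant does not depend on the start node. -/
lemma kemeny_const [Nontrivial V] (hG : G.Connected) (i j : V) : kemeny G i = kemeny G j := by
  rw [kemeny_eq hG, kemeny_eq hG]
  congr 1
  -- The function Σ d(j) h_j is harmonic: at w the targets j ≠ w contribute d(w)(M - d(w)), and the
  -- target w contributes d(w)(d(w) - M).
  refine eq_of_sum_adj_sub_eq_zero hG (f := fun w => ∑ j, (G.degree j : ℝ) * potential G j w)
    (fun w => ?_) i j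
  have h1 : ∀ z, (if G.Adj w z then ∑ j, (G.degree j : ℝ) * potential G j w -
      ∑ j, (G.degree j : ℝ) * potential G j z else 0) =
      ∑ j, (G.degree j : ℝ) * if G.Adj w z then potential G j w - potential G j z else 0 := by
    intro z
    split_ifs <;> simp [mul_sub]
  rw [Finset.sum_congr rfl fun z _ => h1 z, Finset.sum_comm]
  simp only [← Finset.mul_sum]
  rw [← Finset.add_sum_erase _ _ (Finset.mem_univ w), sum_adj_potential_self hG,
    Finset.sum_congr rfl fun v hv => by rw [sum_adj_potential hG (Finset.ne_of_mem_erase hv).symm],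
    ← Finset.sum_mul, ← sum_degree_eq, ← Finset.add_sum_erase _ _ (Finset.mem_univ w)]
  ring

lemma sum_sq_adj_sub (f : V → ℝ) :
    0 ≤ ∑ w, f w * ∑ z, (if G.Adj w z then f w - f z else 0) := by
  have h : ∑ w, f w * ∑ z, (if G.Adj w z then f w - f z else 0) =
      ∑ w, ∑ z, (if G.Adj w z then -(f z * (f w - f z)) else 0) := by
    simp only [Finset.mul_sum]
    conv_lhs => rw [Finset.sum_comm]
    refine Finset.sum_congr rfl fun w _ => Finset.sum_congr rfl fun z _ => ?_
    simp only [G.adj_comm z w]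
    split_ifs <;> ring
  have h2 : 2 * ∑ w, f w * ∑ z, (if G.Adj w z then f w - f z else 0) =
      ∑ w, ∑ z, (if G.Adj w z then (f w - f z) ^ 2 else 0) := by
    rw [two_mul]
    conv_lhs => arg 2; rw [h]
    rw [← Finset.sum_add_distrib]
    refine Finset.sum_congr rfl fun w _ => ?_
    rw [Finset.mul_sum, ← Finset.sum_add_distrib]
    refine Finset.sum_congr rfl fun z _ => ?_
    split_ifs <;> ring
  have h3 : 0 ≤ ∑ w, ∑ z, (if G.Adj w z then (f w - f z) ^ 2 else 0) :=
    Finset.sum_nonneg fun w _ => Finset.sum_nonneg fun z _ => by split_ifs <;> positivity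
  linarith

/-- Cauchy-Schwarz for the Dirichlet form E, applied to h = `potential G j` and the indicator 1_j:
here E(h, 1_j) = d(j) - M, E(1_j, 1_j) = d(j) and E(h, h) = Σ d(i) h(i). -/
lemma le_sum_degree_mul_potential [Nontrivial V] (hG : G.Connected) (j : V) :
    (2 * (G.edgeFinset.card : ℝ) - G.degree j) ^ 2 ≤
      G.degree j * ∑ i, (G.degree i : ℝ) * potential G j i := by
  set M := 2 * (G.edgeFinset.card : ℝ)
  set d := (G.degree j : ℝ)
  have hd : 0 < d := degree_pos' hG j
  -- The minimiser of E(h - c·1_j).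
  set c := (d - M) / d
  have hcd : c * d = d - M := div_mul_cancel₀ _ hd.ne'
  set g : V → ℝ := fun i => potential G j i - c * if i = j then 1 else 0
  have hL : ∀ w, (∑ z, if G.Adj w z then g w - g z else 0) =
      (∑ z, if G.Adj w z then potential G j w - potential G j z else 0) -
        c * ((if w = j then d else 0) - if G.Adj w j then 1 else 0) := by
    intro w
    have h1 : (∑ z, if G.Adj w z then ((if w = j then 1 else 0) - if z = j then (1 : ℝ) else 0)
        else 0) = (if w = j then d else 0) - if G.Adj w j then 1 else 0 := by
      have h2 : ∀ z, (if G.Adj w z then ((if w = j then 1 else 0) - if z = j then (1 : ℝ) else 0)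
          else 0) = (if w = j then if G.Adj w z then 1 else 0 else 0) -
            if z = j then if G.Adj w z then 1 else 0 else 0 := by
        intro z
        split_ifs <;> simp
      rw [Finset.sum_congr rfl fun z _ => h2 z, Finset.sum_sub_distrib,
        Finset.sum_ite_eq' Finset.univ j]
      by_cases hw : w = j
      · subst hw
        simp only [if_true, Finset.mem_univ, ← SimpleGraph.degree_eq_sum_if_adj]
        rfl
      · simp [hw]
    rw [← h1, Finset.mul_sum, ← Finset.sum_sub_distrib]
    refine Finset.sum_congr rfl fun z _ => ?_
    simp only [g]
    split_ifs <;> ring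
  have hpos := sum_sq_adj_sub (G := G) g
  simp only [hL] at hpos
  have hsum : ∀ w, g w * ((∑ z, if G.Adj w z then potential G j w - potential G j z else 0) -
        c * ((if w = j then d else 0) - if G.Adj w j then 1 else 0)) =
      (G.degree w : ℝ) * potential G j w - (if w = j then c * ((d - M) - c * d) else 0) +
        c * (if G.Adj w j then potential G j w else 0) := by
    intro w
    by_cases hw : w = j
    · subst hw
      rw [sum_adj_potential_self hG]
      simp only [g, potential_self, if_true, SimpleGraph.irrefl, if_false]
      ring
    · rw [sum_adj_potential hG hw]
      simp only [g, if_neg hw]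
      split_ifs <;> ring
  rw [Finset.sum_congr rfl fun w _ => hsum w, Finset.sum_add_distrib, Finset.sum_sub_distrib,
    Finset.sum_ite_eq' Finset.univ j, ← Finset.mul_sum] at hpos
  have hN : (∑ w, if G.Adj w j then potential G j w else 0) = M - d := by
    have := sum_adj_potential_self hG j
    simp only [potential_self, zero_sub] at this
    have h2 : ∀ w, (if G.Adj w j then potential G j w else 0) =
        -(if G.Adj j w then - potential G j w else 0) := by
      intro w
      simp only [G.adj_comm w j]
      split_ifs <;> simp
    rw [Finset.sum_congr rfl fun w _ => h2 w, Finset.sum_neg_distrib, this]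
    ring
  rw [hN, hcd, if_pos (Finset.mem_univ j)] at hpos
  have h := mul_nonneg hd.le hpos
  have h' : d * (∑ i, (G.degree i : ℝ) * potential G j i - c * (d - M - (d - M)) + c * (M - d)) =
      d * ∑ i, (G.degree i : ℝ) * potential G j i - (M - d) ^ 2 := by
    linear_combination (M - d) * hcd
  linarith

/-- The Kemeny constant of a connected graph on `n` nodes is at least that of `K_n`. -/
lemma le_kemeny [Nontrivial V] (hG : G.Connected) (i : V) :
    ((Fintype.card V : ℝ) - 1) ^ 2 / Fintype.card V ≤ kemeny G i := by
  set M := 2 * (G.edgeFinset.card : ℝ) with hM_def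
  have hM : 0 < M := edges_pos hG
  have hn : 0 < (Fintype.card V : ℝ) := Nat.cast_pos.2 Fintype.card_pos
  -- As κ is the same from every start node, it may be averaged over the stationary start; the sum
  -- then splits by targets j.
  have h1 : M ^ 2 * kemeny G i = ∑ j, (G.degree j : ℝ) * ∑ w, (G.degree w : ℝ) * potential G j w := by
    have : M * kemeny G i = ∑ w, (G.degree w : ℝ) * kemeny G w := by
      rw [hM_def, ← sum_degree_eq, Finset.sum_mul]
      exact Finset.sum_congr rfl fun w _ => by rw [kemeny_const hG i w]
    rw [sq, mul_assoc, this, Finset.mul_sum]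
    simp only [Finset.mul_sum]
    rw [Finset.sum_comm]
    refine Finset.sum_congr rfl fun w _ => ?_
    rw [kemeny_eq hG, mul_left_comm, mul_div_cancel₀ _ hM.ne', Finset.mul_sum]
    exact Finset.sum_congr rfl fun j _ => by ring
  have h2 : ∑ j, (M - G.degree j) ^ 2 ≤ M ^ 2 * kemeny G i := by
    rw [h1]
    exact Finset.sum_le_sum fun j _ => le_sum_degree_mul_potential hG j
  have h3 : (∑ j : V, (M - G.degree j)) ^ 2 ≤ Fintype.card V * ∑ j, (M - G.degree j) ^ 2 :=
    sq_sum_le_card_mul_sum_sq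
  have h4 : ∑ j : V, (M - G.degree j) = M * (Fintype.card V - 1) := by
    rw [Finset.sum_sub_distrib, sum_degree_eq]
    simp
    ring
  rw [h4] at h3
  rw [div_le_iff₀ hn]
  have h5 : M ^ 2 * ((Fintype.card V : ℝ) - 1) ^ 2 ≤ M ^ 2 * (kemeny G i * Fintype.card V) := by
    calc _ = (M * ((Fintype.card V : ℝ) - 1)) ^ 2 := by ring
      _ ≤ _ := h3
      _ ≤ Fintype.card V * (M ^ 2 * kemeny G i) := by gcongr
      _ = _ := by ring
  exact le_of_mul_le_mul_left h5 (by positivity)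

end HittingTimes

/-! ### Range of a single sample. -/

section Range

variable {V : Type*} [Fintype V] [DecidableEq V] {G : SimpleGraph V} [DecidableRel G.Adj]

lemma vol_mono {S B : Set V} (h : S ⊆ B) : vol G S ≤ vol G B := by
  classical
  exact Finset.sum_le_sum_of_subset_of_nonneg
    (Finset.monotone_filter_right _ fun _ _ hx => h hx) fun _ _ _ => Nat.cast_nonneg _

lemma vol_nonneg (S : Set V) : 0 ≤ vol G S := Finset.sum_nonneg fun _ _ => Nat.cast_nonneg _

lemma vol_univ : vol G Set.univ = 2 * (G.edgeFinset.card : ℝ) := by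
  simp [vol, sum_degree_eq]

/-- With x = vol(S ∩ B), the product is at most x(M - x), which lies below its tangent line at x =
θM. For θ ≤ 1/2 that line has nonnegative slope, so x may be replaced by vol(S). The slope parameter
is kept free for a later choice. -/
lemma mul_sub_vol_mem {S B : Set V} {θ : ℝ} (hθ : θ ≤ 1 / 2) :
    vol G (S ∩ B) * (2 * (G.edgeFinset.card : ℝ) - vol G B) ∈
      Set.Icc 0 ((1 - 2 * θ) * (2 * (G.edgeFinset.card : ℝ)) * vol G S +
        θ ^ 2 * (2 * (G.edgeFinset.card : ℝ)) ^ 2) := by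
  set M := 2 * (G.edgeFinset.card : ℝ) with hM
  have hM0 : 0 ≤ M := by positivity
  have h1 : vol G B ≤ M := by
    rw [hM, ← vol_univ]
    exact vol_mono (Set.subset_univ _)
  have h2 := vol_mono (G := G) (Set.inter_subset_right (s := S) (t := B))
  have h3 := vol_mono (G := G) (Set.inter_subset_left (s := S) (t := B))
  have h4 := vol_nonneg (G := G) (S ∩ B)
  refine ⟨mul_nonneg h4 (sub_nonneg.2 h1), ?_⟩
  have h5 : vol G (S ∩ B) * (M - vol G B) ≤ vol G (S ∩ B) * (M - vol G (S ∩ B)) := by gcongr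
  have h6 : (1 - 2 * θ) * M * vol G (S ∩ B) ≤ (1 - 2 * θ) * M * vol G S :=
    mul_le_mul_of_nonneg_left h3 (mul_nonneg (by linarith) hM0)
  nlinarith [sq_nonneg (vol G (S ∩ B) - θ * M)]

open scoped Classical in
lemma sum_degree_mul_ite (S B : Set V) (P : Prop) (c : ℝ) :
    ∑ v, (G.degree v : ℝ) * (if v ∈ S then if P ∧ v ∈ B then c else 0 else 0) =
      if P then vol G (S ∩ B) * c else 0 := by
  by_cases hP : P
  · simp only [hP, true_and, if_true, vol, Finset.sum_mul, Finset.sum_filter]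
    refine Finset.sum_congr rfl fun v _ => ?_
    by_cases h1 : v ∈ S <;> by_cases h2 : v ∈ B <;> simp [h1, h2]
  · simp [hP]

open scoped Classical in
lemma sampleValue_eq_sum_edges {T T₀ : SimpleGraph V} (hT : T.IsTree) (r : V) :
    sampleValue G T T₀ r = ∑ a, ∑ b, if IsParent T₀ r b a then
      (if IsParent T r b a then vol G (subtree T₀ r a ∩ subtree T r a) *
        (2 * (G.edgeFinset.card : ℝ) - vol G (subtree T r a)) else 0) -
      (if IsParent T r a b then vol G (subtree T₀ r a ∩ subtree T r b) *
        (2 * (G.edgeFinset.card : ℝ) - vol G (subtree T r b)) else 0) else 0 := by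
  rw [sampleValue_eq G hT]
  simp only [Finset.mul_sum]
  rw [Finset.sum_comm]
  refine Finset.sum_congr rfl fun a _ => ?_
  rw [Finset.sum_comm]
  refine Finset.sum_congr rfl fun b _ => ?_
  by_cases h : IsParent T₀ r b a
  · rw [if_pos h, ← sum_degree_mul_ite, ← sum_degree_mul_ite, ← Finset.sum_sub_distrib]
    refine Finset.sum_congr rfl fun v _ => ?_
    by_cases hv : v ∈ subtree T₀ r a <;> simp [h, hv, mul_sub]
  · simp [h]

-- A tree `T` directs an edge in only one way, so at most one of the two terms of each edge of `T₀`
-- is nonzero.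
open scoped Classical in
lemma abs_sampleValue_le_sum {T : SimpleGraph V} (T₀ : SimpleGraph V) (hT : T.IsTree) (r : V)
    {θ : ℝ} (hθ : θ ≤ 1 / 2) : |sampleValue G T T₀ r| ≤
      ∑ a, ∑ b, if IsParent T₀ r b a then
        (1 - 2 * θ) * (2 * (G.edgeFinset.card : ℝ)) * vol G (subtree T₀ r a) +
          θ ^ 2 * (2 * (G.edgeFinset.card : ℝ)) ^ 2 else 0 := by
  rw [sampleValue_eq_sum_edges hT]
  refine (Finset.abs_sum_le_sum_abs _ _).trans (Finset.sum_le_sum fun a _ =>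
    (Finset.abs_sum_le_sum_abs _ _).trans (Finset.sum_le_sum fun b _ => ?_))
  have ha := mul_sub_vol_mem (G := G) (S := subtree T₀ r a) (B := subtree T r a) hθ
  have hb := mul_sub_vol_mem (G := G) (S := subtree T₀ r a) (B := subtree T r b) hθ
  by_cases h : IsParent T₀ r b a
  · rw [if_pos h, if_pos h]
    by_cases h1 : IsParent T r b a
    · rw [if_pos h1, if_neg h1.asymm, sub_zero, abs_of_nonneg ha.1]
      exact ha.2
    · rw [if_neg h1, zero_sub, abs_neg]
      split_ifs
      · rw [abs_of_nonneg hb.1]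
        exact hb.2
      · rw [abs_zero]
        exact ha.1.trans ha.2
  · rw [if_neg h, if_neg h, abs_zero]

open scoped Classical in
lemma sum_isParent {T : SimpleGraph V} (hT : T.IsTree) (r : V) :
    (∑ a, ∑ b, if IsParent T r b a then (1 : ℝ) else 0) = Fintype.card V - 1 := by
  have h : ∀ a, (∑ b, if IsParent T r b a then (1 : ℝ) else 0) = 1 - if a = r then 1 else 0 := by
    intro a
    by_cases ha : a = r
    · subst ha
      simp [not_isParent_root]
    · rw [if_neg ha, Finset.sum_eq_single (parent T r a)]
      · simp [isParent_parent hT ha]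
      · exact fun b _ hb => if_neg fun h => hb (h.unique hT (isParent_parent hT ha))
      · simp
  rw [Finset.sum_congr rfl fun a _ => h a, Finset.sum_sub_distrib]
  simp

-- Double counting: v lies in as many non-root subtrees as its depth.
open scoped Classical in
lemma sum_vol_subtree {T : SimpleGraph V} (hT : T.IsTree) (r : V) :
    (∑ a, ∑ b, if IsParent T r b a then vol G (subtree T r a) else 0) =
      ∑ v, (G.degree v : ℝ) * (T.dist r v : ℝ) := by
  have h : ∀ v, (T.dist r v : ℝ) =
      ∑ a, ∑ b, if IsParent T r b a ∧ v ∈ subtree T r a then 1 else 0 := by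
    intro v
    have := sum_path_sub hT r (fun w => (T.dist r w : ℝ)) v
    rw [SimpleGraph.dist_self, Nat.cast_zero, sub_zero] at this
    rw [← this]
    refine Finset.sum_congr rfl fun a _ => Finset.sum_congr rfl fun b _ => ?_
    split_ifs with h
    · simp [h.1.2]
    · rfl
  simp only [h, Finset.mul_sum]
  conv_rhs => rw [Finset.sum_comm]
  refine Finset.sum_congr rfl fun a _ => ?_
  conv_rhs => rw [Finset.sum_comm]
  refine Finset.sum_congr rfl fun b _ => ?_
  split_ifs with h1
  · simp [h1, vol, Finset.sum_filter]
  · simp [h1]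

lemma sum_degree_mul_dist_le {T : SimpleGraph V} (hG : G.Connected) {r : V}
    (hT : ∀ u, T.dist r u = G.dist r u) :
    ∑ v, (G.degree v : ℝ) * (T.dist r v : ℝ) ≤
      G.diam * (2 * (G.edgeFinset.card : ℝ) - G.degree r) := by
  have : Nonempty V := hG.nonempty
  have htop : G.ediam ≠ ⊤ := G.connected_iff_ediam_ne_top.1 hG
  have h1 := Finset.add_sum_erase _ (fun w => (G.degree w : ℝ)) (Finset.mem_univ r)
  rw [sum_degree_eq] at h1
  rw [← h1, add_sub_cancel_left, ← Finset.add_sum_erase _ _ (Finset.mem_univ r), Finset.mul_sum,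
    SimpleGraph.dist_self, Nat.cast_zero, mul_zero, zero_add]
  refine Finset.sum_le_sum fun v _ => ?_
  rw [mul_comm, hT]
  gcongr
  exact SimpleGraph.dist_le_diam htop

lemma abs_sampleValue_le_of_param {T T₀ : SimpleGraph V} (hG : G.Connected) (hT : T.IsTree)
    (hT₀ : T₀.IsTree) {r : V} (hd : ∀ u, T₀.dist r u = G.dist r u) {θ : ℝ} (hθ : θ ≤ 1 / 2) :
    |sampleValue G T T₀ r| ≤ (1 - 2 * θ) * (2 * (G.edgeFinset.card : ℝ)) *
      (G.diam * (2 * (G.edgeFinset.card : ℝ) - G.degree r)) +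
        ((Fintype.card V : ℝ) - 1) * θ ^ 2 * (2 * (G.edgeFinset.card : ℝ)) ^ 2 := by
  classical
  refine (abs_sampleValue_le_sum T₀ hT r hθ).trans ?_
  set M := 2 * (G.edgeFinset.card : ℝ) with hM
  have hM0 : 0 ≤ M := by positivity
  have h : ∀ a b, (if IsParent T₀ r b a then
      (1 - 2 * θ) * M * vol G (subtree T₀ r a) + θ ^ 2 * M ^ 2 else 0) =
      (1 - 2 * θ) * M * (if IsParent T₀ r b a then vol G (subtree T₀ r a) else 0) +
        θ ^ 2 * M ^ 2 * if IsParent T₀ r b a then 1 else 0 := by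
    intro a b
    split_ifs <;> simp
  simp only [h, Finset.sum_add_distrib, ← Finset.mul_sum]
  rw [sum_isParent hT₀, sum_vol_subtree hT₀]
  have h1 := sum_degree_mul_dist_le hG hd
  have h2 := mul_le_mul_of_nonneg_left h1 (mul_nonneg (by linarith : 0 ≤ 1 - 2 * θ) hM0)
  linarith

lemma diam_pos [Nontrivial V] (hG : G.Connected) : 0 < G.diam := by
  have htop : G.ediam ≠ ⊤ := G.connected_iff_ediam_ne_top.1 hG
  obtain ⟨a, b, hab⟩ := exists_pair_ne V
  exact (hG.pos_dist_of_ne hab).trans_le (SimpleGraph.dist_le_diam htop)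

lemma abs_sampleValue_le [Nontrivial V] {T T₀ : SimpleGraph V} (hG : G.Connected) (hT : T.IsTree)
    (hT₀ : T₀.IsTree) {r : V} (hd : ∀ u, T₀.dist r u = G.dist r u) :
    |sampleValue G T T₀ r| ≤ (2 * (G.edgeFinset.card : ℝ)) ^ 2 * G.diam *
      (((Fintype.card V : ℝ) - 1) ^ 2 / (Fintype.card V : ℝ) ^ 2) := by
  have key := fun θ (hθ : θ ≤ 1 / 2) => abs_sampleValue_le_of_param (G := G) hG hT hT₀ hd hθ
  have hn2 : 2 ≤ Fintype.card V := Fintype.one_lt_card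
  have hΔ := diam_pos hG
  have hdeg0 : (0 : ℝ) ≤ G.degree r := Nat.cast_nonneg _
  by_cases h1 : G.diam = 1
  · have htop : G = ⊤ := SimpleGraph.diam_eq_one.1 h1
    have hdeg : ∀ v, (G.degree v : ℝ) = Fintype.card V - 1 := by
      intro v
      have : G.degree v = Fintype.card V - 1 := by
        subst htop
        convert SimpleGraph.complete_graph_degree v
      rw [this, Nat.cast_sub (by omega), Nat.cast_one]
    have hM : 2 * (G.edgeFinset.card : ℝ) = Fintype.card V * ((Fintype.card V : ℝ) - 1) := by
      rw [← sum_degree_eq, Finset.sum_congr rfl fun v _ => hdeg v, Finset.sum_const,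
        Finset.card_univ, nsmul_eq_mul]
    have hn : (2 : ℝ) ≤ Fintype.card V := by exact_mod_cast hn2
    -- In the complete graph every degree is M/n, and θ = 1/n makes the parametric bound equal to
    -- the target. Here the term d(r) cannot be dropped.
    refine (key (1 / Fintype.card V) (one_div_le_one_div_of_le two_pos hn)).trans_eq ?_
    rw [hM, hdeg, h1]
    have : (Fintype.card V : ℝ) ≠ 0 := by positivity
    field_simp
    push_cast
    ring
  · have hΔ2 : (2 : ℝ) ≤ G.diam := by exact_mod_cast (by omega : 2 ≤ G.diam)
    set M := 2 * (G.edgeFinset.card : ℝ) with hM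
    have hM0 : 0 ≤ M := by positivity
    suffices h : ∃ θ : ℝ, θ ≤ 1 / 2 ∧
        (1 - 2 * θ) * G.diam + ((Fintype.card V : ℝ) - 1) * θ ^ 2 ≤
          G.diam * (((Fintype.card V : ℝ) - 1) ^ 2 / (Fintype.card V : ℝ) ^ 2) by
      obtain ⟨θ, hθ, h⟩ := h
      refine (key θ hθ).trans ?_
      have h2 : (1 - 2 * θ) * M * (G.diam * (M - G.degree r)) ≤
          (1 - 2 * θ) * M * (G.diam * M) := by
        have : 0 ≤ 1 - 2 * θ := by linarith
        gcongr
        linarith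
      have h3 := mul_le_mul_of_nonneg_left h (sq_nonneg M)
      linarith
    by_cases hn5 : 5 ≤ Fintype.card V
    · have hn : (5 : ℝ) ≤ Fintype.card V := by exact_mod_cast hn5
      generalize (Fintype.card V : ℝ) = N at hn
      have hN1 : 0 < N - 1 := by linarith
      -- The condition θ ≤ 1/2 is N ≥ 5. The gain over Δ is (4Δ - 4)/(N - 1), which is at least
      -- 2Δ/(N - 1) because Δ ≥ 2.
      refine ⟨2 / (N - 1), by rw [div_le_div_iff₀ hN1 two_pos]; linarith, ?_⟩
      have h2 : (1 - 2 * (2 / (N - 1))) * (G.diam : ℝ) + (N - 1) * (2 / (N - 1)) ^ 2 =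
          G.diam - (4 * G.diam - 4) / (N - 1) := by
        field_simp
        ring
      have h3 : 2 * (G.diam : ℝ) / (N - 1) ≤ (4 * G.diam - 4) / (N - 1) := by
        gcongr
        linarith
      have h4 : (N - 1) ^ 2 / N ^ 2 = 1 - (2 * N - 1) / N ^ 2 := by
        have : N ≠ 0 := by linarith
        field_simp
        ring
      have h5 : (2 * N - 1) / N ^ 2 ≤ 2 / (N - 1) := by
        rw [div_le_div_iff₀ (by positivity) hN1]
        nlinarith
      have h6 := mul_le_mul_of_nonneg_left h5 (by linarith : (0 : ℝ) ≤ G.diam)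
      rw [h2, h4]
      calc _ ≤ (G.diam : ℝ) - 2 * G.diam / (N - 1) := by linarith
        _ = G.diam - G.diam * (2 / (N - 1)) := by ring
        _ ≤ _ := by linarith
    -- With θ = 1/2 each edge costs at most M²/4, and the claim becomes n² ≤ 4Δ(n - 1).
    · refine ⟨1 / 2, le_rfl, ?_⟩
      have hn4 : Fintype.card V ≤ 4 := by omega
      generalize Fintype.card V = n at hn2 hn4
      interval_cases n <;> norm_num <;> linarith

end Range

/-! ### Hoeffding's inequality. -/

section Concentration

lemma integral_uniformOn_univ {α : Type*} [MeasurableSpace α] [MeasurableSingletonClass α]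
    [Fintype α] [Nonempty α] (f : α → ℝ) :
    ∫ x, f x ∂(uniformOn (Set.univ : Set α)) = (∑ x, f x) / Fintype.card α := by
  have := isProbabilityMeasure_uniformOn (Set.finite_univ (α := α)) Set.univ_nonempty
  rw [integral_fintype Integrable.of_finite, Finset.sum_div]
  refine Finset.sum_congr rfl fun x _ => ?_
  rw [Measure.real, uniformOn_univ]
  simp [div_eq_inv_mul]

/-- Two-sided Hoeffding inequality for the mean of independent variables bounded by `B`. -/
lemma measureReal_abs_sum_sub_gt_le {Ω : Type*} [MeasurableSpace Ω] {μ : Measure Ω}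
    [IsProbabilityMeasure μ] {ω : ℕ} {X : Fin ω → Ω → ℝ} (hm : ∀ k, AEMeasurable (X k) μ)
    (hi : iIndepFun X μ) {B c : ℝ} (hB : 0 ≤ B) (hX : ∀ k x, |X k x| ≤ B)
    (hc : ∀ k, ∫ x, X k x ∂μ = c) {t : ℝ} (ht : 0 ≤ t) :
    μ.real {x | t < |∑ k, X k x - ω * c|} ≤ 2 * Real.exp (-t ^ 2 / (2 * (ω * B ^ 2))) := by
  have hsub : ∀ k, HasSubgaussianMGF (fun x => X k x - c) ((‖B - -B‖₊ / 2) ^ 2) μ := by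
    intro k
    rw [← hc k]
    exact hasSubgaussianMGF_of_mem_Icc (hm k) (ae_of_all _ fun x => abs_le.1 (hX k x))
  have hi' : iIndepFun (fun k x => X k x - c) μ :=
    hi.comp (fun _ y => y - c) fun _ => measurable_id.sub_const c
  have hi'' : iIndepFun (fun k => -(fun x => X k x - c)) μ :=
    hi'.comp (fun _ y => -y) fun _ => measurable_neg
  have hB2 : ((∑ _k : Fin ω, (‖B - -B‖₊ / 2) ^ 2 : NNReal) : ℝ) = ω * B ^ 2 := by
    have : |B + B| = 2 * B := by rw [abs_of_nonneg (by linarith)]; ring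
    simp [this]
  have h1 := HasSubgaussianMGF.measure_sum_ge_le_of_iIndepFun hi' (s := Finset.univ)
    (fun k _ => hsub k) ht
  have h2 := HasSubgaussianMGF.measure_sum_ge_le_of_iIndepFun hi'' (s := Finset.univ)
    (fun k _ => (hsub k).neg) ht
  rw [hB2] at h1 h2
  rw [two_mul]
  refine le_trans ?_ (add_le_add h1 h2)
  refine le_trans (measureReal_mono ?_) (measureReal_union_le _ _)
  intro x hx
  rcases lt_abs.1 hx.out with h | h
  · left
    simp only [Set.mem_ofPred_eq, Finset.sum_sub_distrib]
    simpa using h.le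
  · right
    simp only [Set.mem_ofPred_eq, Pi.neg_apply, Finset.sum_neg_distrib, Finset.sum_sub_distrib]
    simpa using h.le

end Concentration

/-! ### Expectation of a sample. -/

section Sampling

variable {V : Type*} [Fintype V] [DecidableEq V] {G : SimpleGraph V} [DecidableRel G.Adj]

open scoped Classical in
lemma integral_sampleValue [Nontrivial V] (hG : G.Connected) (i r : V) (T₀ : SpanningTree G)
    {Ω : Type*} [MeasurableSpace Ω] {μ : Measure Ω} {σ : Ω → SpanningTree G}
    (hσ : HasLaw σ (uniformOn Set.univ) μ) :
    ∫ x, sampleValue G (σ x).1 T₀.1 r ∂μ = 2 * (G.edgeFinset.card : ℝ) * kemeny G i := by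
  let _ : Fintype (SpanningTree G) := Subtype.fintype fun T : SimpleGraph V => T ≤ G ∧ T.IsTree
  have : Nonempty (SpanningTree G) := ⟨T₀⟩
  have : MeasurableSingletonClass (SpanningTree G) := ⟨fun _ => trivial⟩
  have h1 : ∫ x, sampleValue G (σ x).1 T₀.1 r ∂μ =
      ∫ T, sampleValue G T.1 T₀.1 r ∂(uniformOn (Set.univ : Set (SpanningTree G))) := by
    rw [← hσ.map_eq, integral_map hσ.aemeasurable
      (measurable_from_top (f := fun T : SpanningTree G =>
        sampleValue G T.1 T₀.1 r)).aestronglyMeasurable]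
  have h2 : ∑ T : SpanningTree G, sampleValue G T.1 T₀.1 r =
      ∑ T ∈ trees G, sampleValue G T T₀.1 r :=
    (Finset.sum_subtype (trees G) (fun T => mem_trees G)
      (fun T => sampleValue G T T₀.1 r)).symm
  have h3 : Fintype.card (SpanningTree G) = (trees G).card :=
    Fintype.card_of_subtype (trees G) fun T => mem_trees G
  rw [h1, integral_uniformOn_univ, h2, h3, sum_sampleValue hG T₀.2.1 T₀.2.2,
    mul_div_cancel_left₀ _ (card_trees_pos hG).ne', kemeny_const hG i r, kemeny_eq hG,
    mul_div_cancel₀ _ (edges_pos hG).ne']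

end Sampling

end TTF

/-! ### The error bound. -/

theorem mainTheorem4 {V : Type*} [Fintype V] [DecidableEq V] [Nontrivial V]
    (G : SimpleGraph V) [DecidableRel G.Adj] (hG : G.Connected)
    (i r : V) (T₀ : TTF.SpanningTree G) (hT₀ : TTF.IsBFSTree G r T₀)
    {Ω : Type*} [MeasurableSpace Ω] (μ : Measure Ω) [IsProbabilityMeasure μ]
    (ω : ℕ) (τ : Fin ω → Ω → TTF.SpanningTree G)
    (hunif : ∀ k, HasLaw (τ k) (uniformOn Set.univ) μ) (hindep : iIndepFun τ μ)
    (ε p_f : ℝ) (hε : 0 < ε) (hp : 0 < p_f)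
    (hω : 8 * (G.edgeFinset.card : ℝ) ^ 2 * (G.diam : ℝ) ^ 2 * Real.log (2 / p_f)
        / ((Fintype.card V : ℝ) ^ 2 * ε ^ 2) ≤ (ω : ℝ)) :
    1 - p_f ≤ μ.real {x | |TTF.ttf G r T₀ (fun k => τ k x) - TTF.kemeny G i|
        ≤ ε * TTF.kemeny G i} := by
  -- For p_f ≥ 1 the claim is void. Otherwise the logarithm is positive, which forces ω > 0 and
  -- makes the division by ω harmless.
  rcases le_or_gt 1 p_f with hp1 | hp1
  · exact (sub_nonpos.2 hp1).trans measureReal_nonneg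
  have hlog : 0 < Real.log (2 / p_f) := Real.log_pos (by rw [lt_div_iff₀ hp]; linarith)
  have hM := TTF.edges_pos hG
  have hΔ : (0 : ℝ) < G.diam := Nat.cast_pos.2 (TTF.diam_pos hG)
  have hn : (2 : ℝ) ≤ Fintype.card V := by exact_mod_cast Fintype.one_lt_card (α := V)
  have hκ := TTF.le_kemeny hG i
  set M := 2 * (G.edgeFinset.card : ℝ) with hM_def
  set κ := TTF.kemeny G i with hκ_def
  set N := (Fintype.card V : ℝ) with hN_def
  set B := M ^ 2 * G.diam * ((N - 1) ^ 2 / N ^ 2) with hB_def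
  have hN1 : 0 < N - 1 := by linarith
  have hκ0 : 0 < κ := lt_of_lt_of_le (by positivity) hκ
  have hB : 0 < B := by positivity
  -- Range against mean: B/(Mκ) ≤ MΔ/n.
  have hBκ : B * N ≤ M ^ 2 * G.diam * κ := by
    calc B * N = M ^ 2 * G.diam * ((N - 1) ^ 2 / N) := by
          rw [hB_def]
          field_simp
      _ ≤ _ := by gcongr
  have hω' : 2 * M ^ 2 * (G.diam : ℝ) ^ 2 * Real.log (2 / p_f) ≤ ω * (N ^ 2 * ε ^ 2) := by
    rw [div_le_iff₀ (by positivity)] at hω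
    calc _ = 8 * (G.edgeFinset.card : ℝ) ^ 2 * (G.diam : ℝ) ^ 2 * Real.log (2 / p_f) := by
          rw [hM_def]
          ring
      _ ≤ _ := hω
  have hω0 : (0 : ℝ) < ω := by
    have h1 : 0 < ω * (N ^ 2 * ε ^ 2) := lt_of_lt_of_le (by positivity) hω'
    exact pos_of_mul_pos_left h1 (by positivity)
  have htail := TTF.measureReal_abs_sum_sub_gt_le (μ := μ)
    (X := fun k x => TTF.sampleValue G (τ k x).1 T₀.1 r) (B := B) (c := M * κ)
    (t := M * ω * (ε * κ))
    (fun k => (measurable_from_top (f := fun T : TTF.SpanningTree G =>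
      TTF.sampleValue G T.1 T₀.1 r)).comp_aemeasurable (hunif k).aemeasurable)
    (hindep.comp (fun _ (T : TTF.SpanningTree G) => TTF.sampleValue G T.1 T₀.1 r)
      fun _ => measurable_from_top)
    hB.le (fun k x => TTF.abs_sampleValue_le hG (τ k x).2.2 T₀.2.2 hT₀)
    (fun k => TTF.integral_sampleValue hG i r T₀ (hunif k)) (by positivity)
  have hexp : 2 * Real.exp (-(M * ω * (ε * κ)) ^ 2 / (2 * (ω * B ^ 2))) ≤ p_f := by
    have h1 : Real.log (2 / p_f) ≤ (M * ω * (ε * κ)) ^ 2 / (2 * (ω * B ^ 2)) := by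
      rw [le_div_iff₀ (by positivity)]
      have h2 : (B * N) ^ 2 ≤ (M ^ 2 * G.diam * κ) ^ 2 := by gcongr
      have h3 : (Real.log (2 / p_f) * (2 * (ω * B ^ 2))) * N ^ 2 ≤
          (M * ω * (ε * κ)) ^ 2 * N ^ 2 := by
        calc _ = 2 * Real.log (2 / p_f) * ω * (B * N) ^ 2 := by ring
          _ ≤ 2 * Real.log (2 / p_f) * ω * (M ^ 2 * G.diam * κ) ^ 2 := by gcongr
          _ = ω * M ^ 2 * κ ^ 2 * (2 * M ^ 2 * (G.diam : ℝ) ^ 2 * Real.log (2 / p_f)) := by ring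
          _ ≤ ω * M ^ 2 * κ ^ 2 * (ω * (N ^ 2 * ε ^ 2)) := by gcongr
          _ = _ := by ring
      exact le_of_mul_le_mul_right h3 (by positivity)
    have h2 : Real.exp (-(M * ω * (ε * κ)) ^ 2 / (2 * (ω * B ^ 2))) ≤ p_f / 2 := by
      rw [neg_div, Real.exp_neg, inv_le_comm₀ (Real.exp_pos _) (by positivity), inv_div,
        ← Real.log_le_iff_le_exp (by positivity)]
      exact h1
    linarith
  have hset : {x | |TTF.ttf G r T₀ (fun k => τ k x) - κ| ≤ ε * κ}ᶜ ⊆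
      {x | M * ω * (ε * κ) < |∑ k, TTF.sampleValue G (τ k x).1 T₀.1 r - ω * (M * κ)|} := by
    intro x hx
    simp only [Set.mem_compl_iff, Set.mem_ofPred_eq, not_le] at hx ⊢
    rw [TTF.ttf_eq, ← hM_def] at hx
    have h1 : ∑ k, TTF.sampleValue G (τ k x).1 T₀.1 r - ω * (M * κ) =
        M * ω * ((∑ k, TTF.sampleValue G (τ k x).1 T₀.1 r) / (M * ω) - κ) := by
      field_simp
    rw [h1, abs_mul, abs_of_pos (mul_pos hM hω0)]
    exact mul_lt_mul_of_pos_left hx (mul_pos hM hω0)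
  have hcompl : μ.real {x | |TTF.ttf G r T₀ (fun k => τ k x) - κ| ≤ ε * κ}ᶜ ≤ p_f :=
    (measureReal_mono hset).trans (htail.trans hexp)
  -- Subadditivity replaces the complement rule, so the event need not be measurable; the samples
  -- are only almost everywhere measurable.
  have hunion := measureReal_union_le (μ := μ)
    {x | |TTF.ttf G r T₀ (fun k => τ k x) - κ| ≤ ε * κ}
    {x | |TTF.ttf G r T₀ (fun k => τ k x) - κ| ≤ ε * κ}ᶜ
  rw [Set.union_compl_self, probReal_univ] at hunion
  linarith
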